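/- Let $n\in\{2,3\}$, let $\Omega\subset\mathbb R^n$ be open, bounded and convex, and let $a_{ij},c_0\in L^\infty(\Omega)$ with $c_0\ge 0$ a.e., $a_{ij}=a_{ji}$ and $\sum_{i,j}a_{ij}(x)\xi_i\xi_j\ge\theta\|\xi\|^2$ for a.e. $x\in\Omega$ and all $\xi\in\mathbb R^n$, for some $\theta>0$. Put $a(y,v)=\int_\Omega\big(\sum_{i,j}a_{ji}\,y_{x_i}v_{x_j}+c_0yv\big)\,dx$. Let $\alpha,\kappa,\tau>0$. Consider conforming simplicial triangulations $\mathcal T_h$ with finitely many cells, such that the interior $\Omega_h$ of the union of the cells is contained in $\Omega$. Write $\rho_T=\operatorname{diam}T$, let $\sigma_T$ be the diameter of the largest ball contained in the cell $T$, let $h=\max_{T\in\mathcal T_h}\rho_T$, and suppose that $$\frac{\rho_T}{\sigma_T}\le\kappa,\qquad \frac{h}{\rho_T}\le\tau\qquad\text{for all }T\in\mathcal T_h .$$ Let $x_1,\dots,x_{N_h}$ be the nodes, that is, the vertices of $\mathcal T_h$ lying in $\Omega_h$ (piecewise linear functions vanishing outside $\Omega_h$) or, alternatively, all vertices of $\mathcal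 T_h$. Let $\phi_1,\dots,\phi_{N_h}$ be the nodal basis functions: $\phi_i$ is affine on each cell, equals $1$ at $x_i$ and $0$ at all other vertices, and is extended by zero outside the union of the cells. (Derivatives of $\phi_i$ are understood almost everywhere.) Put $$K_h=\big(a(\phi_i,\phi_j)\big)_{i,j},\quad M_h=\Big(\int_{\Omega_h}\phi_i\phi_j\,dx\Big)_{i,j},\quad W_h=\operatorname{diag}\Big(\int_{\Omega_h}\phi_i\,dx\Big)_i,\quad G_h=M_h+\alpha K_hM_h^{-1}K_h,$$ and, with $\gamma=4$ if $n=2$ and $\gamma=5$ if $n=3$, $$\mathcal S_h=\frac1\alpha\begin{pmatrix}M_hG_h^{-1}M_h+W_h-M_h&0&0\\0&0&0\\0&0&\gamma M_hW_h^{-1}M_h\end{pmatrix}.$$ Then there exist positive constants $l_1,l_2,u_1,u_2,C$ and $h_0$, depending only on $n,\Omega,(a_{ij}),c_0,\alpha,\kappa,\tau$, such that for every such triangulation with $0<h<h_0$ and every $0\ne\mathbf x\in\mathbb R^{N_h}$ $$l_1h^2\le\frac{\mathbf x^TG_h\mathbf x}{\mathbf x^T\mathbf x}\le u_1\frac1{h^2}\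 \text{ if } n=2,\qquad l_2h^3\le\frac{\mathbf x^TG_h\mathbf x}{\mathbf x^T\mathbf x}\le u_2\frac1h\ \text{ if } n=3 .$$ Moreover, for every such triangulation with $0<h<h_0$ and $N_h\ge1$, the largest eigenvalues $\lambda_{\max}(M_hG_h^{-1}M_h)$ and $\lambda_{\max}(\mathcal S_h)$ exist, and both are at most $Ch^2$ in absolute value if $n=2$ and at most $Ch^3$ in absolute value if $n=3$. -/

import Mathlib

open MeasureTheory Set

noncomputable section

namespace FEM

/-- Euclidean space `ℝⁿ`. -/
abbrev E (n : ℕ) : Type := EuclideanSpace ℝ (Fin n)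

/-! ### Triangulations -/

/-- A (conforming, finite) triangulation in `ℝⁿ`: a finite simplicial complex all of whose
simplices are faces of `n`-dimensional simplices. A simplex is given by its vertex set. -/
structure Triangulation (n : ℕ) where
  complex : Geometry.SimplicialComplex ℝ (E n)
  finite : complex.faces.Finite
  pure : ∀ s ∈ complex.faces, ∃ t ∈ complex.faces, s ⊆ t ∧ t.card = n + 1

/-- The closed simplex with the given vertices. -/
def simplex {n : ℕ} (T : Finset (E n)) : Set (E n) := convexHull ℝ (T : Set (E n))

/-- `ρ_T`, the diameter of the simplex `T`. -/
def rho {n : ℕ} (T : Finset (E n)) : ℝ := Metric.diam (simplex T)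

/-- `σ_T`, the diameter of the largest ball contained in the simplex `T`. -/
def sigma {n : ℕ} (T : Finset (E n)) : ℝ :=
  sSup {d : ℝ | 0 ≤ d ∧ ∃ p : E n, Metric.closedBall p (d / 2) ⊆ simplex T}

namespace Triangulation

variable {n : ℕ} (𝒯 : Triangulation n)

/-- The cells of a triangulation: its `n`-dimensional simplices. -/
def cells : Set (Finset (E n)) := {T | T ∈ 𝒯.complex.faces ∧ T.card = n + 1}

/-- The mesh size `h = max_T ρ_T`. -/
def meshSize : ℝ := sSup (rho '' 𝒯.cells)

/-- `Ω_h`: the interior of the union of the cells. -/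
def domain : Set (E n) := interior (⋃ T ∈ 𝒯.cells, simplex T)

/-- Regularity and quasi-uniformity, with constants `κ` and `τ`. -/
def IsRegularQuasiUniform (κ τ : ℝ) : Prop :=
  ∀ T ∈ 𝒯.cells, rho T / sigma T ≤ κ ∧ 𝒯.meshSize / rho T ≤ τ

/-- All vertices of the triangulation. -/
def vertices : Set (E n) := 𝒯.complex.vertices

/-- The vertices that are not on the boundary of `Ω_h`: the nodes of the space of continuous
piecewise linear functions vanishing outside `Ω_h`. -/
def interiorVertices : Set (E n) := {v | v ∈ 𝒯.vertices ∧ v ∈ 𝒯.domain}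

/-! ### Nodal basis functions -/

/-- `w` is the family of barycentric coordinates of the point `p` with respect to the vertices of
some cell that contains `p`, extended by `0` to all other points. -/
def IsBarycentric (p : E n) (w : E n → ℝ) : Prop :=
  ∃ T ∈ 𝒯.cells, (∀ v ∈ T, 0 ≤ w v) ∧ (∀ v, v ∉ T → w v = 0) ∧
    ∑ v ∈ T, w v = 1 ∧ ∑ v ∈ T, w v • v = p

open scoped Classical in
/-- The nodal basis ("hat") function of the vertex `v`: on each cell it is the barycentric
coordinate belonging to `v` (zero if `v` is not a vertex of the cell), and it vanishes outside the
union of the cells. -/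
def hat (v p : E n) : ℝ :=
  if h : ∃ w, 𝒯.IsBarycentric p w then h.choose v else 0

/-- Barycentric coordinates do not depend on the cell that is used to compute them. -/
theorem IsBarycentric.unique {p : E n} {w w' : E n → ℝ}
    (h : 𝒯.IsBarycentric p w) (h' : 𝒯.IsBarycentric p w') : w = w' := by
  classical
  obtain ⟨S, hS, hS0, hSz, hS1, hSp⟩ := h
  obtain ⟨T, hT, hT0, hTz, hT1, hTp⟩ := h'
  have hmem : p ∈ convexHull ℝ ((S ∩ T : Finset (E n)) : Set (E n)) := by
    rw [Finset.coe_inter]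
    refine 𝒯.complex.inter_subset_convexHull hS.1 hT.1 ⟨?_, ?_⟩
    · exact Finset.mem_convexHull'.2 ⟨w, hS0, hS1, hSp⟩
    · exact Finset.mem_convexHull'.2 ⟨w', hT0, hT1, hTp⟩
  obtain ⟨u, -, hu1, hup⟩ := Finset.mem_convexHull'.1 hmem
  -- an affine combination of the vertices of one cell determines its coefficients
  have key : ∀ R ∈ 𝒯.cells, S ∩ T ⊆ R → ∀ f : E n → ℝ, (∀ v, v ∉ R → f v = 0) →
      ∑ v ∈ R, f v = 1 → ∑ v ∈ R, f v • v = p →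
      f = fun v => if v ∈ S ∩ T then u v else 0 := by
    intro R hR hsub f hfz hf1 hfp
    have hind := (affineIndependent_iff.1 (𝒯.complex.indep hR.1)) Finset.univ
      (fun v => f v - if (v : E n) ∈ S ∩ T then u v else 0)
    have e1 : ∑ v ∈ R, (if v ∈ S ∩ T then u v else 0) = 1 := by
      rw [← Finset.sum_filter, Finset.filter_mem_eq_inter, Finset.inter_eq_right.2 hsub, hu1]
    have e2 : ∑ v ∈ R, (if v ∈ S ∩ T then u v else 0) • v = p := by
      simp only [ite_smul, zero_smul]
      rw [← Finset.sum_filter, Finset.filter_mem_eq_inter, Finset.inter_eq_right.2 hsub, hup]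
    have h1 : ∑ v ∈ R, (f v - if v ∈ S ∩ T then u v else 0) = 0 := by
      rw [Finset.sum_sub_distrib, hf1, e1, sub_self]
    have h2 : ∑ v ∈ R, (f v - if v ∈ S ∩ T then u v else 0) • v = 0 := by
      simp only [sub_smul]
      rw [Finset.sum_sub_distrib, hfp, e2, sub_self]
    rw [← Finset.sum_coe_sort] at h1 h2
    have h3 := hind h1 h2
    funext v
    by_cases hv : v ∈ R
    · exact sub_eq_zero.1 (h3 ⟨v, hv⟩ (Finset.mem_univ _))
    · rw [hfz v hv, if_neg fun hv' => hv (hsub hv')]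
  rw [key S hS Finset.inter_subset_left w hSz hS1 hSp,
    key T hT Finset.inter_subset_right w' hTz hT1 hTp]

/-- On every cell, `hat v` is the barycentric coordinate of `v`. -/
theorem hat_eq {p : E n} {w : E n → ℝ} (h : 𝒯.IsBarycentric p w) (v : E n) :
    𝒯.hat v p = w v := by
  have hex : ∃ w, 𝒯.IsBarycentric p w := ⟨w, h⟩
  rw [hat, dif_pos hex, IsBarycentric.unique 𝒯 hex.choose_spec h]

open scoped Classical in
/-- `φ_i (x_j) = δ_{ij}`. -/
theorem hat_vertex {v q : E n} (hq : q ∈ 𝒯.vertices) :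
    𝒯.hat v q = if v = q then 1 else 0 := by
  obtain ⟨T, hT, hsub, hcard⟩ := 𝒯.pure _ hq
  have hqT : q ∈ T := hsub (Finset.mem_singleton_self q)
  have h : 𝒯.IsBarycentric q (fun v => if v = q then 1 else 0) := by
    refine ⟨T, ⟨hT, hcard⟩, fun v _ => ?_, fun v hv => ?_, ?_, ?_⟩
    · dsimp only
      split_ifs <;> norm_num
    · have hne : v ≠ q := fun e => hv (by rw [e]; exact hqT)
      simp [hne]
    · simp [hqT]
    · simp [hqT]
  exact hat_eq 𝒯 h v

/-! ### Matrices of the finite element discretization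

Throughout, `x : Fin N → ℝⁿ` enumerates the nodes. -/

variable {N : ℕ} (x : Fin N → E n)

/-- The mass matrix `M_h = (∫_{Ω_h} φ_i φ_j)`. -/
def massMatrix : Matrix (Fin N) (Fin N) ℝ :=
  Matrix.of fun i j => ∫ p in 𝒯.domain, 𝒯.hat (x i) p * 𝒯.hat (x j) p

/-- The lumped mass matrix `W_h = diag (∫_{Ω_h} φ_i)`. -/
def lumpedMassMatrix : Matrix (Fin N) (Fin N) ℝ :=
  Matrix.diagonal fun i => ∫ p in 𝒯.domain, 𝒯.hat (x i) p

end Triangulation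

/-- The partial derivative `y_{x_k}`. (For continuous piecewise linear functions the weak
derivative is the classical derivative, which exists almost everywhere.) -/
def pderiv {n : ℕ} (k : Fin n) (y : E n → ℝ) (p : E n) : ℝ :=
  fderiv ℝ y p (EuclideanSpace.single k 1)

/-- The bilinear form `a(y,v) = ∫_Ω (∑_{k,l} a_{lk} y_{x_k} v_{x_l} + c₀ y v)`. -/
def bilinForm {n : ℕ} (Ω : Set (E n)) (a : Fin n → Fin n → E n → ℝ) (c₀ : E n → ℝ)
    (y v : E n → ℝ) : ℝ :=
  ∫ p in Ω, ((∑ k, ∑ l, a l k p * pderiv k y p * pderiv l v p) + c₀ p * y p * v p)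

/-- Assumptions on the coefficients of `L y = -∑ ∂_{x_j} (a_{ij} y_{x_i}) + c₀ y` on `Ω`: bounded
measurable, symmetric, uniformly elliptic with constant `θ`, and `c₀ ≥ 0`. -/
structure IsElliptic {n : ℕ} (Ω : Set (E n)) (a : Fin n → Fin n → E n → ℝ) (c₀ : E n → ℝ)
    (θ : ℝ) : Prop where
  memLp_a : ∀ i j, MemLp (a i j) ⊤ (volume.restrict Ω)
  memLp_c₀ : MemLp c₀ ⊤ (volume.restrict Ω)
  c₀_nonneg : ∀ᵐ p ∂(volume.restrict Ω), 0 ≤ c₀ p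
  symm : ∀ᵐ p ∂(volume.restrict Ω), ∀ i j, a i j p = a j i p
  theta_pos : 0 < θ
  elliptic : ∀ᵐ p ∂(volume.restrict Ω), ∀ ξ : E n,
    θ * ‖ξ‖ ^ 2 ≤ ∑ i, ∑ j, a i j p * ξ i * ξ j

namespace Triangulation

variable {n : ℕ} (𝒯 : Triangulation n) {N : ℕ} (x : Fin N → E n)
  (Ω : Set (E n)) (a : Fin n → Fin n → E n → ℝ) (c₀ : E n → ℝ) (α : ℝ)

/-- The stiffness matrix `K_h = (a(φ_i, φ_j))`. -/
def stiffnessMatrix : Matrix (Fin N) (Fin N) ℝ :=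
  Matrix.of fun i j => bilinForm Ω a c₀ (𝒯.hat (x i)) (𝒯.hat (x j))

/-- `G_h = M_h + α K_h M_h⁻¹ K_h`. -/
def matrixG : Matrix (Fin N) (Fin N) ℝ :=
  𝒯.massMatrix x +
    α • (𝒯.stiffnessMatrix x Ω a c₀ * (𝒯.massMatrix x)⁻¹ * 𝒯.stiffnessMatrix x Ω a c₀)

/-- `M_h G_h⁻¹ M_h`. -/
def matrixMGM : Matrix (Fin N) (Fin N) ℝ :=
  𝒯.massMatrix x * (𝒯.matrixG x Ω a c₀ α)⁻¹ * 𝒯.massMatrix x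

/-- The constant `γ`, equal to `4` for `n = 2` and to `5` for `n = 3`. -/
def gamma (n : ℕ) : ℝ := if n = 2 then 4 else 5

/-- The `3 × 3` block diagonal matrix
`S_h = α⁻¹ diag (M_h G_h⁻¹ M_h + W_h - M_h, 0, γ M_h W_h⁻¹ M_h)`. -/
def matrixS : Matrix ((Fin N ⊕ Fin N) ⊕ Fin N) ((Fin N ⊕ Fin N) ⊕ Fin N) ℝ :=
  (1 / α) • Matrix.fromBlocks
    (Matrix.fromBlocks
      (𝒯.matrixMGM x Ω a c₀ α + 𝒯.lumpedMassMatrix x - 𝒯.massMatrix x) 0 0 0)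
    0 0
    (gamma n • (𝒯.massMatrix x * (𝒯.lumpedMassMatrix x)⁻¹ * 𝒯.massMatrix x))

end Triangulation

/-- `Λ = λ_max(A)`: `Λ` is the largest real eigenvalue of the matrix `A`. -/
def IsLargestEigenvalue {ι : Type*} [Fintype ι] (A : Matrix ι ι ℝ) (Λ : ℝ) : Prop :=
  IsGreatest {μ : ℝ | ∃ v : ι → ℝ, v ≠ 0 ∧ A.mulVec v = μ • v} Λ

/-- The Rayleigh quotient `zᵀ A z / zᵀ z`. -/
def rayleigh {ι : Type*} [Fintype ι] (A : Matrix ι ι ℝ) (z : ι → ℝ) : ℝ :=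
  (z ⬝ᵥ A.mulVec z) / (z ⬝ᵥ z)

end FEM

end

/-!
Since `K_h M_h⁻¹ K_h` is positive semidefinite, `M_h ≤ G_h` in the Loewner order, and everything
reduces to two-sided bounds on `M_h` and a bound on the norm of `K_h`.

The mass matrix is comparable to `hⁿ`: on a cell, shrunk by a fixed factor towards the vertex where
the modulus of a finite element function is largest, that function stays bounded below by half of
its maximum; conversely the Cauchy–Schwarz inequality and `∑ i, φ i ≤ 1` give `M_h ≤ W_h`, and the
diagonal entries of `W_h` are at most the volume of a ball of radius `h`. Every cell contains a ball
of radius comparable to `h`, so an affine function with values in `[0, 1]` has gradient `O(1 / h)`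
there. As at most `n + 1` basis functions are nonzero at any point, the absolute row sums of `K_h`
are `O(h ^ (n - 2))`, and Gershgorin's theorem bounds `K_h ^ 2`. Finally `B ↦ B⁻¹` is antitone, so
`M_h G_h⁻¹ M_h ≤ M_h` and `M_h W_h⁻¹ M_h ≤ M_h`, whence `0 ≤ 𝒮_h ≤ O(hⁿ)` block by block.
-/

namespace FEM

section LoewnerOrder

open Matrix
open scoped MatrixOrder ComplexOrder

variable {ι 𝕜 : Type*} [RCLike 𝕜]

theorem posDef_of_le {A B : Matrix ι ι 𝕜} (hA : A.PosDef) (hAB : A ≤ B) : B.PosDef := by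
  simpa only [add_sub_cancel] using hA.add_posSemidef (Matrix.le_iff.1 hAB)

theorem posDef_smul_one [DecidableEq ι] {c : ℝ} (hc : 0 < c) : (c • 1 : Matrix ι ι 𝕜).PosDef :=
  PosDef.one.smul hc

theorem posSemidef_fromBlocks_zero [Finite ι] {κ : Type*} [Finite κ] {P : Matrix ι ι 𝕜}
    {Q : Matrix κ κ 𝕜} (hP : P.PosSemidef) (hQ : Q.PosSemidef) :
    (fromBlocks P 0 0 Q).PosSemidef := by
  have := Fintype.ofFinite ι
  have := Fintype.ofFinite κ
  refine .of_dotProduct_mulVec_nonneg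
    (hP.isHermitian.fromBlocks (conjTranspose_zero ..) hQ.isHermitian) fun z => ?_
  have hz : star z ⬝ᵥ fromBlocks P 0 0 Q *ᵥ z = star (z ∘ Sum.inl) ⬝ᵥ P *ᵥ (z ∘ Sum.inl) +
      star (z ∘ Sum.inr) ⬝ᵥ Q *ᵥ (z ∘ Sum.inr) := by
    simp [fromBlocks_mulVec, dotProduct, Fintype.sum_sum_type]
  rw [hz]
  exact add_nonneg (hP.dotProduct_mulVec_nonneg _) (hQ.dotProduct_mulVec_nonneg _)

variable [DecidableEq ι]

theorem fromBlocks_zero_le_smul_one [Finite ι] {κ : Type*} [Finite κ] [DecidableEq κ]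
    {P : Matrix ι ι 𝕜} {Q : Matrix κ κ 𝕜} {c : ℝ} (hP : P ≤ c • 1) (hQ : Q ≤ c • 1) :
    fromBlocks P 0 0 Q ≤ c • 1 := by
  have h := posSemidef_fromBlocks_zero (Matrix.le_iff.1 hP) (Matrix.le_iff.1 hQ)
  rw [Matrix.le_iff, ← fromBlocks_one, fromBlocks_smul, sub_eq_add_neg, fromBlocks_neg,
    fromBlocks_add]
  simpa only [smul_zero, neg_zero, add_zero, ← sub_eq_add_neg] using h

variable [Fintype ι]

/-- Both inequalities say that a Schur complement of `[B, 1; 1, A⁻¹]` is positive semidefinite. -/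
theorem inv_le_inv_of_posDef_of_le {A B : Matrix ι ι 𝕜} (hA : A.PosDef) (hAB : A ≤ B) :
    B⁻¹ ≤ A⁻¹ := by
  have hB := posDef_of_le hA hAB
  let := hA.inv.isUnit.invertible
  let := hB.isUnit.invertible
  have hBA : (fromBlocks B 1 1ᴴ A⁻¹).PosSemidef := by
    rw [PosDef.fromBlocks₂₂ _ _ hA.inv]
    simpa [nonsing_inv_nonsing_inv _ ((isUnit_iff_isUnit_det _).1 hA.isUnit)]
      using Matrix.le_iff.1 hAB
  rw [PosDef.fromBlocks₁₁ _ _ hB] at hBA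
  simpa [Matrix.le_iff] using hBA

theorem mul_inv_mul_le_self {A B : Matrix ι ι 𝕜} (hA : A.PosDef) (hAB : A ≤ B) :
    A * B⁻¹ * A ≤ A :=
  calc A * B⁻¹ * A ≤ A * A⁻¹ * A :=
        hA.isHermitian.isSelfAdjoint.conjugate_le_conjugate (inv_le_inv_of_posDef_of_le hA hAB)
    _ = A := by rw [mul_nonsing_inv _ ((isUnit_iff_isUnit_det _).1 hA.isUnit), one_mul]

theorem mul_inv_mul_nonneg {K M : Matrix ι ι 𝕜} (hK : K.IsHermitian) (hM : M.PosDef) :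
    0 ≤ K * M⁻¹ * K :=
  hK.isSelfAdjoint.conjugate_nonneg hM.inv.posSemidef.nonneg

theorem mul_inv_mul_le_inv_smul {K M : Matrix ι ι 𝕜} (hK : K.IsHermitian) {m : ℝ} (hm : 0 < m)
    (hM : m • 1 ≤ M) : K * M⁻¹ * K ≤ m⁻¹ • (K * K) :=
  calc K * M⁻¹ * K ≤ K * (m • 1)⁻¹ * K :=
        hK.isSelfAdjoint.conjugate_le_conjugate
          (inv_le_inv_of_posDef_of_le (posDef_smul_one hm) hM)
    _ = m⁻¹ • (K * K) := by
        have hinv : (m • 1 : Matrix ι ι 𝕜)⁻¹ = m⁻¹ • 1 :=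
          inv_eq_right_inv (by simp [hm.ne'])
        simp [hinv]

end LoewnerOrder

section Eigenvalues

open Matrix
open scoped MatrixOrder

variable {ι : Type*} [Fintype ι]

theorem dotProduct_mulVec_le_of_le {A B : Matrix ι ι ℝ} (hAB : A ≤ B) (z : ι → ℝ) :
    z ⬝ᵥ A *ᵥ z ≤ z ⬝ᵥ B *ᵥ z := by
  simpa [sub_mulVec, dotProduct_sub] using (Matrix.le_iff.1 hAB).dotProduct_mulVec_nonneg z

theorem le_of_dotProduct_mulVec_le {A B : Matrix ι ι ℝ} (hA : A.IsHermitian) (hB : B.IsHermitian)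
    (hAB : ∀ z, z ⬝ᵥ A *ᵥ z ≤ z ⬝ᵥ B *ᵥ z) : A ≤ B :=
  Matrix.le_iff.2 <| .of_dotProduct_mulVec_nonneg (hB.sub hA) fun z => by
    simpa [sub_mulVec, dotProduct_sub] using hAB z

theorem dotProduct_self_pos {z : ι → ℝ} (hz : z ≠ 0) : 0 < z ⬝ᵥ z := by
  simpa using dotProduct_star_self_pos_iff.2 hz

theorem rayleigh_eq_of_mulVec_eq_smul {A : Matrix ι ι ℝ} {μ : ℝ} {v : ι → ℝ} (hv : v ≠ 0)
    (hAv : A *ᵥ v = μ • v) : rayleigh A v = μ := by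
  rw [rayleigh, hAv, dotProduct_smul, smul_eq_mul, mul_div_cancel_right₀]
  exact (dotProduct_self_pos hv).ne'

variable [DecidableEq ι]

theorem le_smul_one_of_sum_abs_le {A : Matrix ι ι ℝ} (hA : A.IsHermitian) {R : ℝ}
    (hR : ∀ i, ∑ j, |A i j| ≤ R) : A ≤ R • 1 := by
  have hB : (R • 1 - A).IsHermitian := (isHermitian_one.smul (.all R)).sub hA
  rw [Matrix.le_iff, hB.posSemidef_iff_eigenvalues_nonneg]
  intro i
  obtain ⟨k, hk⟩ := eigenvalue_mem_ball <|
    Module.End.hasEigenvalue_iff_mem_spectrum.2 <|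
      (spectrum_toLin' (R • 1 - A)).symm ▸ hB.eigenvalues_mem_spectrum_real i
  have hoff : ∑ j ∈ Finset.univ.erase k, ‖(R • 1 - A) k j‖ = ∑ j ∈ Finset.univ.erase k, |A k j| :=
    Finset.sum_congr rfl fun j hj => by
      simp [Matrix.one_apply_ne (Finset.ne_of_mem_erase hj).symm]
  have hrow := (Finset.add_sum_erase _ (fun j => |A k j|) (Finset.mem_univ k)).trans_le (hR k)
  rw [hoff, Metric.mem_closedBall, Real.dist_eq] at hk
  have hdiag : (R • 1 - A) k k = R - A k k := by simp
  rw [hdiag] at hk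
  rw [Pi.zero_apply]
  linarith [neg_le_of_abs_le hk, le_abs_self (A k k)]

theorem mul_self_le_smul_one_of_sum_abs_le {K : Matrix ι ι ℝ} (hK : K.IsHermitian) {R : ℝ}
    (hR : ∀ i, ∑ j, |K i j| ≤ R) : K * K ≤ R ^ 2 • 1 := by
  have hKK : (K * K).IsHermitian := by
    simpa only [hK.eq] using isHermitian_mul_conjTranspose_self K
  refine le_smul_one_of_sum_abs_le hKK fun i => ?_
  have hR0 : 0 ≤ R := (Finset.sum_nonneg fun _ _ => abs_nonneg _).trans (hR i)
  calc ∑ j, |(K * K) i j| ≤ ∑ j, ∑ k, |K i k| * |K k j| :=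
        Finset.sum_le_sum fun j _ => (Finset.abs_sum_le_sum_abs _ _).trans_eq (by simp [abs_mul])
    _ = ∑ k, |K i k| * ∑ j, |K k j| := by rw [Finset.sum_comm]; simp only [Finset.mul_sum]
    _ ≤ ∑ k, |K i k| * R := by gcongr with k; exact hR k
    _ = (∑ k, |K i k|) * R := (Finset.sum_mul ..).symm
    _ ≤ R ^ 2 := by rw [sq]; gcongr; exact hR i

theorem le_rayleigh {A : Matrix ι ι ℝ} {c : ℝ} (hA : c • 1 ≤ A) {z : ι → ℝ} (hz : z ≠ 0) :
    c ≤ rayleigh A z :=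
  (le_div_iff₀ (dotProduct_self_pos hz)).2 <| by
    simpa [smul_mulVec] using dotProduct_mulVec_le_of_le hA z

theorem rayleigh_le {A : Matrix ι ι ℝ} {c : ℝ} (hA : A ≤ c • 1) {z : ι → ℝ} (hz : z ≠ 0) :
    rayleigh A z ≤ c :=
  (div_le_iff₀ (dotProduct_self_pos hz)).2 <| by
    simpa [smul_mulVec] using dotProduct_mulVec_le_of_le hA z

theorem setOf_eigenvalue_eq_spectrum (A : Matrix ι ι ℝ) :
    {μ : ℝ | ∃ v : ι → ℝ, v ≠ 0 ∧ A *ᵥ v = μ • v} = spectrum ℝ A := by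
  ext μ
  rw [← spectrum_toLin', ← Module.End.hasEigenvalue_iff_mem_spectrum,
    Module.End.hasEigenvalue_iff, Submodule.ne_bot_iff]
  simp [and_comm]

theorem exists_isLargestEigenvalue_abs_le [Nonempty ι] {A : Matrix ι ι ℝ} (hA : A.PosSemidef)
    {c : ℝ} (hc : A ≤ c • 1) : ∃ Λ, IsLargestEigenvalue A Λ ∧ |Λ| ≤ c := by
  obtain ⟨i, hi⟩ := Finite.exists_max hA.isHermitian.eigenvalues
  have hmax : IsLargestEigenvalue A (hA.isHermitian.eigenvalues i) := by
    rw [IsLargestEigenvalue, setOf_eigenvalue_eq_spectrum,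
      hA.isHermitian.spectrum_real_eq_range_eigenvalues]
    exact ⟨mem_range_self i, forall_mem_range.2 hi⟩
  refine ⟨_, hmax, ?_⟩
  rw [abs_of_nonneg (hA.eigenvalues_nonneg i)]
  obtain ⟨v, hv, hAv⟩ := hmax.1
  exact rayleigh_eq_of_mulVec_eq_smul hv hAv ▸ rayleigh_le hc hv

end Eigenvalues

section Simplex

variable {n : ℕ}

theorem isCompact_simplex (T : Finset (E n)) : IsCompact (simplex T) :=
  T.finite_toSet.isCompact_convexHull ℝ

theorem convex_simplex (T : Finset (E n)) : Convex ℝ (simplex T) := convex_convexHull ℝ _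

theorem volume_frontier_simplex (T : Finset (E n)) : volume (frontier (simplex T)) = 0 :=
  (convex_simplex T).addHaar_frontier volume

theorem mem_simplex_of_mem {T : Finset (E n)} {v : E n} (hv : v ∈ T) : v ∈ simplex T :=
  subset_convexHull ℝ _ hv

theorem exists_vertex_forall_abs_le {T : Finset (E n)} (hT : T.Nonempty) (f : E n →ᵃ[ℝ] ℝ) :
    ∃ w ∈ T, ∀ p ∈ simplex T, |f p| ≤ |f w| := by
  obtain ⟨w, hw, hmax⟩ := T.exists_max_image (fun v => |f v|) hT
  have hconv : Convex ℝ (f ⁻¹' Icc (-|f w|) |f w|) := (convex_Icc _ _).affine_preimage f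
  exact ⟨w, hw, fun p hp => abs_le.2 <|
    convexHull_min (fun v hv => abs_le.1 (hmax v hv)) hconv hp⟩

theorem sq_div_four_le_sq_homothety {V : Type*} [AddCommGroup V] [Module ℝ V] {f : V →ᵃ[ℝ] ℝ}
    {w p : V} (hp : |f p| ≤ |f w|) : f w ^ 2 / 4 ≤ f (AffineMap.homothety w (1 / 4 : ℝ) p) ^ 2 := by
  have hfp : f (AffineMap.homothety w (1 / 4 : ℝ) p) = 3 / 4 * f w + 1 / 4 * f p := by
    rw [AffineMap.homothety_eq_lineMap, AffineMap.apply_lineMap, AffineMap.lineMap_apply_ring]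
    ring
  have hprod : |f w * f p| ≤ f w ^ 2 := by
    rw [abs_mul, ← sq_abs, sq]
    gcongr
  rw [hfp]
  nlinarith [neg_le_of_abs_le hprod, sq_nonneg (f w + f p)]

theorem volume_real_homothety_image (w : E n) {r : ℝ} (hr : 0 ≤ r) (S : Set (E n)) :
    volume.real (AffineMap.homothety w r '' S) = r ^ n * volume.real S := by
  rw [measureReal_def, Measure.addHaar_image_homothety, ENNReal.toReal_mul,
    finrank_euclideanSpace_fin, ENNReal.toReal_ofReal (abs_nonneg _), abs_of_nonneg (by positivity),
    ← measureReal_def]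

/-- Shrinking the simplex by the factor `1 / 4` towards a vertex `w` at which `|f|` is maximal
leaves a simplex on which `|f| ≥ 3 / 4 |f w| - 1 / 4 |f w|`. -/
theorem volume_simplex_mul_sq_le_setIntegral {T : Finset (E n)} {f : E n →ᵃ[ℝ] ℝ} {w : E n}
    (hw : w ∈ T) (hmax : ∀ p ∈ simplex T, |f p| ≤ |f w|) :
    volume.real (simplex T) * f w ^ 2 ≤ 4 ^ (n + 1) * ∫ p in simplex T, f p ^ 2 := by
  set S := AffineMap.homothety w (1 / 4 : ℝ) '' simplex T
  have hS : IsCompact S :=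
    (isCompact_simplex T).image (AffineMap.continuous_of_finiteDimensional _)
  have hST : S ⊆ simplex T := by
    rintro _ ⟨p, hp, rfl⟩
    have hquarter : (1 / 4 : ℝ) ∈ Icc 0 1 := by norm_num [mem_Icc]
    exact (convex_simplex T).lineMap_mem (mem_simplex_of_mem hw) hp hquarter
  have hint : IntegrableOn (fun p => f p ^ 2) (simplex T) :=
    (f.continuous_of_finiteDimensional.pow 2).continuousOn.integrableOn_compact
      (isCompact_simplex T)
  have hle : ∫ _ in S, f w ^ 2 / 4 ≤ ∫ p in simplex T, f p ^ 2 := calc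
    ∫ _ in S, f w ^ 2 / 4 ≤ ∫ p in S, f p ^ 2 :=
        setIntegral_mono_on (integrableOn_const hS.measure_ne_top) (hint.mono_set hST)
          hS.isClosed.measurableSet <| by
            rintro _ ⟨p, hp, rfl⟩
            exact sq_div_four_le_sq_homothety (hmax p hp)
    _ ≤ ∫ p in simplex T, f p ^ 2 :=
        setIntegral_mono_set hint (ae_of_all _ fun p => sq_nonneg (f p)) hST.eventuallyLE
  calc volume.real (simplex T) * f w ^ 2
      = 4 ^ (n + 1) * (volume.real S * (f w ^ 2 / 4)) := by
        rw [volume_real_homothety_image w (by norm_num), one_div, inv_pow]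
        field_simp
        ring
    _ = 4 ^ (n + 1) * ∫ _ in S, f w ^ 2 / 4 := by rw [setIntegral_const, smul_eq_mul]
    _ ≤ 4 ^ (n + 1) * ∫ p in simplex T, f p ^ 2 := mul_le_mul_of_nonneg_left hle (by positivity)

theorem volume_simplex_mul_sum_sq_le_setIntegral (T : Finset (E n)) (f : E n →ᵃ[ℝ] ℝ) :
    volume.real (simplex T) * ∑ v ∈ T, f v ^ 2
      ≤ T.card * (4 ^ (n + 1) * ∫ p in simplex T, f p ^ 2) := by
  obtain rfl | hT := T.eq_empty_or_nonempty
  · simp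
  obtain ⟨w, hw, hmax⟩ := exists_vertex_forall_abs_le hT f
  calc volume.real (simplex T) * ∑ v ∈ T, f v ^ 2
      ≤ volume.real (simplex T) * (T.card * f w ^ 2) := by
        gcongr
        rw [← nsmul_eq_mul]
        exact Finset.sum_le_card_nsmul _ _ _ fun v hv => sq_le_sq.2 (hmax v (mem_simplex_of_mem hv))
    _ = T.card * (volume.real (simplex T) * f w ^ 2) := mul_left_comm ..
    _ ≤ T.card * (4 ^ (n + 1) * ∫ p in simplex T, f p ^ 2) :=
        mul_le_mul_of_nonneg_left (volume_simplex_mul_sq_le_setIntegral hw hmax) (Nat.cast_nonneg _)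

end Simplex

theorem abs_linear_le_of_mapsTo_Icc {V : Type*} [NormedAddCommGroup V] [NormedSpace ℝ V]
    {f : V →ᵃ[ℝ] ℝ} {q : V} {δ : ℝ} (hδ : 0 < δ) (hf : MapsTo f (Metric.closedBall q δ) (Icc 0 1))
    (u : V) : |f.linear u| ≤ ‖u‖ / δ := by
  obtain rfl | hu := eq_or_ne u 0
  · simp
  have hu' := norm_pos_iff.2 hu
  have hmem : (δ / ‖u‖) • u + q ∈ Metric.closedBall q δ := by
    rw [mem_closedBall_iff_norm, add_sub_cancel_right, norm_smul, norm_div, norm_norm,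
      div_mul_cancel₀ _ hu'.ne', Real.norm_of_nonneg hδ.le]
  have hfq := hf (Metric.mem_closedBall_self hδ.le)
  have hfu := hf hmem
  rw [← vadd_eq_add, f.map_vadd, vadd_eq_add, map_smul, smul_eq_mul] at hfu
  have hle : |δ / ‖u‖ * f.linear u| ≤ 1 :=
    abs_le.2 ⟨by linarith [hfu.1, hfq.2], by linarith [hfu.2, hfq.1]⟩
  rw [abs_mul, abs_of_pos (by positivity)] at hle
  rw [le_div_iff₀ hδ]
  field_simp at hle
  linarith

namespace Triangulation

variable {n : ℕ} {𝒯 : Triangulation n} {S T : Finset (E n)}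

theorem finite_cells (𝒯 : Triangulation n) : 𝒯.cells.Finite := 𝒯.finite.subset fun _ h => h.1

theorem exists_cell_of_mem_vertices {v : E n} (hv : v ∈ 𝒯.vertices) : ∃ T ∈ 𝒯.cells, v ∈ T := by
  obtain ⟨T, hT, hvT, hcard⟩ := 𝒯.pure _ hv
  exact ⟨T, ⟨hT, hcard⟩, hvT (Finset.mem_singleton_self v)⟩

theorem interior_simplex_subset_domain (hT : T ∈ 𝒯.cells) : interior (simplex T) ⊆ 𝒯.domain :=
  interior_mono (subset_biUnion_of_mem (u := fun T : Finset (E n) => simplex T) hT)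

theorem rho_le_meshSize (hT : T ∈ 𝒯.cells) : rho T ≤ 𝒯.meshSize :=
  le_csSup (𝒯.finite_cells.image _).bddAbove (mem_image_of_mem _ hT)

/-- The vertices of a cell form an affine basis of `ℝⁿ`, whose coordinates are the barycentric
coordinates of the cell. -/
def cellBasis (hT : T ∈ 𝒯.cells) : AffineBasis T ℝ (E n) where
  toFun := (↑)
  ind' := 𝒯.complex.indep hT.1
  tot' := by
    rw [(𝒯.complex.indep hT.1).affineSpan_eq_top_iff_card_eq_finrank_add_one]
    simp [hT.2]

theorem coe_cellBasis (hT : T ∈ 𝒯.cells) : ⇑(cellBasis hT) = ((↑) : T → E n) := rfl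

theorem range_cellBasis (hT : T ∈ 𝒯.cells) : range (cellBasis hT) = T := Subtype.range_coe

theorem simplex_eq_setOf_nonneg_coord (hT : T ∈ 𝒯.cells) :
    simplex T = {p | ∀ v, 0 ≤ (cellBasis hT).coord v p} := by
  rw [simplex, ← range_cellBasis hT, AffineBasis.convexHull_eq_nonneg_coord]

theorem interior_simplex_eq_setOf_pos_coord (hT : T ∈ 𝒯.cells) :
    interior (simplex T) = {p | ∀ v, 0 < (cellBasis hT).coord v p} := by
  rw [simplex, ← range_cellBasis hT, AffineBasis.interior_convexHull]

theorem interior_simplex_nonempty (hT : T ∈ 𝒯.cells) : (interior (simplex T)).Nonempty := by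
  rw [simplex, ← range_cellBasis hT, interior_convexHull_nonempty_iff_affineSpan_eq_top]
  exact (cellBasis hT).tot

open scoped Classical in
theorem isBarycentric_coord (hT : T ∈ 𝒯.cells) {p : E n} (hp : p ∈ simplex T) :
    𝒯.IsBarycentric p fun v => if hv : v ∈ T then (cellBasis hT).coord ⟨v, hv⟩ p else 0 := by
  rw [simplex_eq_setOf_nonneg_coord hT] at hp
  refine ⟨T, hT, fun v hv => by simpa [hv] using hp ⟨v, hv⟩, fun v hv => dif_neg hv, ?_, ?_⟩
  · rw [← Finset.sum_coe_sort]
    simpa using (cellBasis hT).sum_coord_apply_eq_one p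
  · rw [← Finset.sum_coe_sort]
    simpa [coe_cellBasis] using (cellBasis hT).linear_combination_coord_eq_self p

theorem hat_eq_coord (hT : T ∈ 𝒯.cells) {p : E n} (hp : p ∈ simplex T) (v : T) :
    𝒯.hat v p = (cellBasis hT).coord v p := by
  classical
  rw [𝒯.hat_eq (isBarycentric_coord hT hp), dif_pos v.2]

theorem hat_eq_zero_of_notMem (hT : T ∈ 𝒯.cells) {v p : E n} (hp : p ∈ simplex T) (hv : v ∉ T) :
    𝒯.hat v p = 0 := by
  classical
  rw [𝒯.hat_eq (isBarycentric_coord hT hp), dif_neg hv]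

theorem exists_affineMap_eqOn_hat (hT : T ∈ 𝒯.cells) (v : E n) :
    ∃ f : E n →ᵃ[ℝ] ℝ, EqOn (𝒯.hat v) f (simplex T) := by
  by_cases hv : v ∈ T
  · exact ⟨(cellBasis hT).coord ⟨v, hv⟩, fun p hp => hat_eq_coord hT hp ⟨v, hv⟩⟩
  · exact ⟨0, fun p hp => hat_eq_zero_of_notMem hT hp hv⟩

theorem sum_hat_eq_one (hT : T ∈ 𝒯.cells) {p : E n} (hp : p ∈ simplex T) :
    ∑ v ∈ T, 𝒯.hat v p = 1 := by
  rw [← Finset.sum_coe_sort, ← (cellBasis hT).sum_coord_apply_eq_one p]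
  exact Finset.sum_congr rfl fun v _ => hat_eq_coord hT hp v

theorem cell_eq_of_mem_interior (hS : S ∈ 𝒯.cells) (hT : T ∈ 𝒯.cells) {p : E n}
    (hpS : p ∈ interior (simplex S)) (hpT : p ∈ simplex T) : S = T := by
  refine Finset.eq_of_subset_of_card_le (fun v hv => ?_) (hT.2.trans hS.2.symm).le
  by_contra hvT
  have hpos : 0 < (cellBasis hS).coord ⟨v, hv⟩ p := by
    rw [interior_simplex_eq_setOf_pos_coord hS] at hpS
    exact hpS ⟨v, hv⟩
  rw [← hat_eq_coord hS (interior_subset hpS), hat_eq_zero_of_notMem hT hpT hvT] at hpos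
  exact hpos.false

theorem hat_nonneg (v p : E n) : 0 ≤ 𝒯.hat v p := by
  rw [hat]
  split_ifs with h
  · obtain ⟨T, -, hnonneg, hzero, -⟩ := h.choose_spec
    by_cases hv : v ∈ T
    exacts [hnonneg v hv, (hzero v hv).ge]
  · rfl

theorem exists_cell_of_hat_ne_zero {v p : E n} (h : 𝒯.hat v p ≠ 0) :
    ∃ T ∈ 𝒯.cells, p ∈ simplex T ∧ v ∈ T := by
  rw [hat] at h
  split_ifs at h with hex
  · obtain ⟨T, hT, hnonneg, hzero, hone, hp⟩ := hex.choose_spec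
    exact ⟨T, hT, Finset.mem_convexHull'.2 ⟨_, hnonneg, hone, hp⟩, not_imp_comm.1 (hzero v) h⟩
  · exact absurd rfl h

theorem support_hat_subset (v : E n) :
    Function.support (𝒯.hat v) ⊆ ⋃ T ∈ 𝒯.cells, simplex T := fun _ hp => by
  obtain ⟨T, hT, hpT, -⟩ := exists_cell_of_hat_ne_zero hp
  exact mem_biUnion hT hpT

theorem mem_closedBall_of_hat_ne_zero {v p : E n} (h : 𝒯.hat v p ≠ 0) :
    p ∈ Metric.closedBall v 𝒯.meshSize := by
  obtain ⟨T, hT, hp, hv⟩ := exists_cell_of_hat_ne_zero h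
  exact (Metric.dist_le_diam_of_mem (isCompact_simplex T).isBounded hp
    (mem_simplex_of_mem hv)).trans (rho_le_meshSize hT)

section Family

variable {ι : Type*} [Fintype ι] {x : ι → E n}

theorem sum_hat_le_one (hx : Function.Injective x) (p : E n) : ∑ i, 𝒯.hat (x i) p ≤ 1 := by
  classical
  by_cases h : ∃ i, 𝒯.hat (x i) p ≠ 0
  · obtain ⟨i, hi⟩ := h
    obtain ⟨T, hT, hp, -⟩ := exists_cell_of_hat_ne_zero hi
    calc ∑ i, 𝒯.hat (x i) p = ∑ v ∈ Finset.univ.image x, 𝒯.hat v p :=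
          (Finset.sum_image (f := fun v => 𝒯.hat v p) hx.injOn).symm
      _ = ∑ v ∈ Finset.univ.image x ∩ T, 𝒯.hat v p :=
          (Finset.sum_subset Finset.inter_subset_left fun v hv hvT =>
            hat_eq_zero_of_notMem hT hp fun hvT' => hvT (Finset.mem_inter.2 ⟨hv, hvT'⟩)).symm
      _ ≤ ∑ v ∈ T, 𝒯.hat v p :=
          Finset.sum_le_sum_of_subset_of_nonneg Finset.inter_subset_right
            fun v _ _ => hat_nonneg v p
      _ = 1 := sum_hat_eq_one hT hp
  · push Not at h
    simp [h]

open scoped Classical in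
theorem card_hat_ne_zero_le (hx : Function.Injective x) (p : E n) :
    (Finset.univ.filter fun i => 𝒯.hat (x i) p ≠ 0).card ≤ n + 1 := by
  obtain hempty | ⟨i, hi⟩ := (Finset.univ.filter fun i => 𝒯.hat (x i) p ≠ 0).eq_empty_or_nonempty
  · simp [hempty]
  · obtain ⟨T, hT, hp, -⟩ := exists_cell_of_hat_ne_zero (Finset.mem_filter.1 hi).2
    rw [← hT.2]
    exact Finset.card_le_card_of_injOn x (fun j hj => of_not_not fun hjT =>
      (Finset.mem_filter.1 hj).2 (hat_eq_zero_of_notMem hT hp hjT)) hx.injOn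

end Family

theorem hat_le_one (v p : E n) : 𝒯.hat v p ≤ 1 := by
  simpa using sum_hat_le_one (𝒯 := 𝒯) (x := fun _ : Unit => v)
    (Function.injective_of_subsingleton _) p

theorem continuousOn_hat (v : E n) : ContinuousOn (𝒯.hat v) (⋃ T ∈ 𝒯.cells, simplex T) := by
  have := 𝒯.finite_cells.to_subtype
  rw [biUnion_eq_iUnion]
  refine (locallyFinite_of_finite _).continuousOn_iUnion
    (fun T => (isCompact_simplex T.1).isClosed) fun T => ?_
  obtain ⟨f, hf⟩ := exists_affineMap_eqOn_hat T.2 v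
  exact f.continuous_of_finiteDimensional.continuousOn.congr hf

theorem measurable_hat (v : E n) : Measurable (𝒯.hat v) := by
  classical
  have hmeas : MeasurableSet (⋃ T ∈ 𝒯.cells, simplex T) :=
    𝒯.finite_cells.measurableSet_biUnion fun T _ => (isCompact_simplex T).isClosed.measurableSet
  rw [← indicator_eq_self.2 (support_hat_subset v), ← piecewise_eq_indicator]
  exact (continuousOn_hat v).measurable_piecewise continuousOn_const hmeas

theorem pderiv_hat_eq_zero {v p : E n} (h : 𝒯.hat v p = 0) (k : Fin n) :
    pderiv k (𝒯.hat v) p = 0 := by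
  have hmin : IsLocalMin (𝒯.hat v) p := .of_forall fun q => h.trans_le (hat_nonneg v q)
  rw [pderiv, hmin.fderiv_eq_zero, zero_apply]

end Triangulation

section InscribedBall

variable {n : ℕ} [Nontrivial (E n)] {T : Finset (E n)} {q : E n} {d : ℝ}

theorem le_rho_of_closedBall_subset (hd : 0 ≤ d) (hq : Metric.closedBall q (d / 2) ⊆ simplex T) :
    d ≤ rho T :=
  calc d = Metric.diam (Metric.closedBall q (d / 2)) := by
        rw [Metric.diam_closedBall_eq q (by positivity), mul_div_cancel₀ d two_ne_zero]
    _ ≤ rho T := Metric.diam_mono hq (isCompact_simplex T).isBounded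

theorem le_sigma_of_closedBall_subset (hd : 0 ≤ d) (hq : Metric.closedBall q (d / 2) ⊆ simplex T) :
    d ≤ sigma T :=
  le_csSup ⟨rho T, fun _ ⟨hr, _, hp⟩ => le_rho_of_closedBall_subset hr hp⟩ ⟨hd, q, hq⟩

end InscribedBall

theorem exists_closedBall_subset_of_lt_sigma {n : ℕ} {T : Finset (E n)} {r : ℝ} (hr : 0 ≤ r)
    (hrσ : r < sigma T) : ∃ q, Metric.closedBall q (r / 2) ⊆ simplex T := by
  obtain hempty | hne :=
    {d : ℝ | 0 ≤ d ∧ ∃ p : E n, Metric.closedBall p (d / 2) ⊆ simplex T}.eq_empty_or_nonempty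
  · rw [sigma, hempty, Real.sSup_empty] at hrσ
    exact absurd hrσ hr.not_gt
  · obtain ⟨d, ⟨-, q, hq⟩, hrd⟩ := exists_lt_of_lt_csSup hne hrσ
    exact ⟨q, (Metric.closedBall_subset_closedBall (by linarith)).trans hq⟩

namespace Triangulation

variable {n : ℕ} {𝒯 : Triangulation n} {T : Finset (E n)}

theorem sigma_pos [Nontrivial (E n)] (hT : T ∈ 𝒯.cells) : 0 < sigma T := by
  obtain ⟨q, hq⟩ := interior_simplex_nonempty hT
  obtain ⟨ε, hε, hball⟩ := Metric.nhds_basis_closedBall.mem_iff.1 (mem_interior_iff_mem_nhds.1 hq)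
  have hε2 : 2 * ε / 2 = ε := mul_div_cancel_left₀ ε two_ne_zero
  exact (by positivity : 0 < 2 * ε).trans_le
    (le_sigma_of_closedBall_subset (q := q) (by positivity) (hε2.symm ▸ hball))

theorem rho_pos [Nontrivial (E n)] (hT : T ∈ 𝒯.cells) : 0 < rho T := by
  obtain ⟨q, hq⟩ := exists_closedBall_subset_of_lt_sigma (half_pos (sigma_pos hT)).le
    (half_lt_self (sigma_pos hT))
  exact (half_pos (sigma_pos hT)).trans_le
    (le_rho_of_closedBall_subset (half_pos (sigma_pos hT)).le hq)

theorem nontrivial_of_meshSize_pos (hh : 0 < 𝒯.meshSize) : Nontrivial (E n) := by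
  by_contra hn
  have := not_nontrivial_iff_subsingleton.1 hn
  refine hh.not_ge (Real.sSup_nonpos ?_)
  rintro _ ⟨T, -, rfl⟩
  exact (Metric.diam_subsingleton subsingleton_of_subsingleton).le

/-- Every cell contains a closed ball of radius `δ`. This is the form in which regularity and
quasi-uniformity enter the estimates. -/
def CellsContainBall (𝒯 : Triangulation n) (δ : ℝ) : Prop :=
  ∀ T ∈ 𝒯.cells, ∃ q, Metric.closedBall q δ ⊆ simplex T

theorem IsRegularQuasiUniform.cellsContainBall {κ τ : ℝ} (hκ : 0 < κ) (hτ : 0 < τ)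
    (hreg : 𝒯.IsRegularQuasiUniform κ τ) (hh : 0 < 𝒯.meshSize) :
    𝒯.CellsContainBall (𝒯.meshSize / (4 * κ * τ)) := by
  intro T hT
  have := nontrivial_of_meshSize_pos hh
  have hρσ : rho T ≤ κ * sigma T := (div_le_iff₀ (sigma_pos hT)).1 (hreg T hT).1
  have hhρ : 𝒯.meshSize ≤ τ * rho T := (div_le_iff₀ (rho_pos hT)).1 (hreg T hT).2
  have hlt : 𝒯.meshSize / (2 * κ * τ) < sigma T := by
    rw [div_lt_iff₀ (by positivity)]
    nlinarith
  obtain ⟨q, hq⟩ := exists_closedBall_subset_of_lt_sigma (by positivity) hlt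
  exact ⟨q, by convert hq using 2; ring⟩

theorem ae_notMem_frontier (𝒯 : Triangulation n) :
    ∀ᵐ p : E n, ∀ T ∈ 𝒯.cells, p ∉ frontier (simplex T) :=
  (ae_ball_iff 𝒯.finite_cells.countable).2 fun T _ =>
    measure_eq_zero_iff_ae_notMem.1 (volume_frontier_simplex T)

theorem abs_pderiv_hat_le_of_mem_interior {δ : ℝ} (hδ : 0 < δ) (hball : 𝒯.CellsContainBall δ)
    (hT : T ∈ 𝒯.cells) {p : E n} (hp : p ∈ interior (simplex T)) (v : E n) (k : Fin n) :
    |pderiv k (𝒯.hat v) p| ≤ 1 / δ := by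
  obtain ⟨f, hf⟩ := exists_affineMap_eqOn_hat hT v
  obtain ⟨q, hq⟩ := hball T hT
  have hderiv : HasFDerivAt f f.linear.toContinuousLinearMap p := by
    rw [f.decomp]
    exact f.linear.toContinuousLinearMap.hasFDerivAt.add_const _
  have heq : 𝒯.hat v =ᶠ[nhds p] f := hf.eventuallyEq_of_mem (mem_interior_iff_mem_nhds.1 hp)
  have hmaps : MapsTo f (Metric.closedBall q δ) (Icc 0 1) := fun y hy =>
    hf (hq hy) ▸ ⟨hat_nonneg v y, hat_le_one v y⟩
  rw [pderiv, (hderiv.congr_of_eventuallyEq heq).fderiv]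
  simpa using abs_linear_le_of_mapsTo_Icc hδ hmaps (EuclideanSpace.single k 1)

theorem ae_abs_pderiv_hat_le {δ : ℝ} (hδ : 0 < δ) (hball : 𝒯.CellsContainBall δ) :
    ∀ᵐ p : E n, ∀ v k, |pderiv k (𝒯.hat v) p| ≤ 1 / δ := by
  filter_upwards [𝒯.ae_notMem_frontier] with p hp v k
  by_cases hv : 𝒯.hat v p = 0
  · rw [pderiv_hat_eq_zero hv, abs_zero]
    positivity
  · obtain ⟨T, hT, hpT, -⟩ := exists_cell_of_hat_ne_zero hv
    have hint : p ∈ interior (simplex T) :=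
      of_not_not fun h => hp T hT ⟨subset_closure hpT, h⟩
    exact abs_pderiv_hat_le_of_mem_interior hδ hball hT hint v k

end Triangulation

/-- The volume of the Euclidean unit ball of `ℝⁿ`. -/
noncomputable def unitBallVolume (n : ℕ) : ℝ := volume.real (Metric.ball (0 : E n) 1)

theorem unitBallVolume_pos (n : ℕ) : 0 < unitBallVolume n :=
  ENNReal.toReal_pos (Metric.measure_ball_pos _ _ one_pos).ne' measure_ball_lt_top.ne

theorem volume_real_closedBall {n : ℕ} (q : E n) {r : ℝ} (hr : 0 ≤ r) :
    volume.real (Metric.closedBall q r) = unitBallVolume n * r ^ n := by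
  rw [Measure.addHaar_real_closedBall volume q hr, finrank_euclideanSpace_fin, mul_comm,
    unitBallVolume]

namespace Triangulation

open Matrix
open scoped MatrixOrder

variable {n : ℕ} {𝒯 : Triangulation n}

theorem integrable_hat (v : E n) : Integrable (𝒯.hat v) := by
  refine (integrableOn_iff_integrable_of_support_subset fun _ hp =>
    mem_closedBall_of_hat_ne_zero hp).1 ?_
  exact Measure.integrableOn_of_bounded measure_closedBall_lt_top.ne
    (measurable_hat v).aestronglyMeasurable (M := 1)
    (ae_of_all _ fun p => (Real.norm_of_nonneg (hat_nonneg v p)).trans_le (hat_le_one v p))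

theorem integrable_hat_mul_hat (v w : E n) : Integrable fun p => 𝒯.hat v p * 𝒯.hat w p :=
  (integrable_hat v).mul_bdd (c := 1) (measurable_hat w).aestronglyMeasurable
    (ae_of_all _ fun p => (Real.norm_of_nonneg (hat_nonneg w p)).trans_le (hat_le_one w p))

theorem integral_domain_hat_le (hh : 0 ≤ 𝒯.meshSize) (v : E n) :
    ∫ p in 𝒯.domain, 𝒯.hat v p ≤ unitBallVolume n * 𝒯.meshSize ^ n :=
  calc ∫ p in 𝒯.domain, 𝒯.hat v p ≤ ∫ p, 𝒯.hat v p :=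
        setIntegral_le_integral (integrable_hat v) (ae_of_all _ (hat_nonneg v))
    _ = ∫ p in Metric.closedBall v 𝒯.meshSize, 𝒯.hat v p :=
        (setIntegral_eq_integral_of_forall_compl_eq_zero fun p hp =>
          of_not_not fun h => hp (mem_closedBall_of_hat_ne_zero h)).symm
    _ ≤ ∫ _ in Metric.closedBall v 𝒯.meshSize, 1 :=
        setIntegral_mono (integrable_hat v).integrableOn
          (integrableOn_const measure_closedBall_lt_top.ne) (hat_le_one v)
    _ = unitBallVolume n * 𝒯.meshSize ^ n := by
        rw [setIntegral_const, smul_eq_mul, mul_one, volume_real_closedBall v hh]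

section Interpolant

variable {ι : Type*} [Fintype ι] {x : ι → E n}

/-- The finite element function `∑ i, z i • φ i` with nodal values `z`. -/
noncomputable def interpolant (𝒯 : Triangulation n) (x : ι → E n) (z : ι → ℝ) (p : E n) : ℝ :=
  ∑ i, z i * 𝒯.hat (x i) p

theorem interpolant_node (hx : Function.Injective x) {i : ι} (hi : x i ∈ 𝒯.vertices)
    (z : ι → ℝ) : 𝒯.interpolant x z (x i) = z i := by
  classical
  simp [interpolant, 𝒯.hat_vertex hi, hx.eq_iff]

theorem exists_affineMap_eqOn_interpolant {T : Finset (E n)} (hT : T ∈ 𝒯.cells) (x : ι → E n)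
    (z : ι → ℝ) : ∃ f : E n →ᵃ[ℝ] ℝ, EqOn (𝒯.interpolant x z) f (simplex T) := by
  choose f hf using fun i => exists_affineMap_eqOn_hat hT (x i)
  refine ⟨(Fintype.linearCombination ℝ z).toAffineMap.comp (AffineMap.pi f), fun p hp => ?_⟩
  simp [interpolant, fun i => hf i hp, Fintype.linearCombination_apply, mul_comm]

theorem sq_interpolant_eq_sum (x : ι → E n) (z : ι → ℝ) (p : E n) :
    𝒯.interpolant x z p ^ 2 = ∑ i, ∑ j, z i * z j * (𝒯.hat (x i) p * 𝒯.hat (x j) p) := by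
  rw [interpolant, sq, Finset.sum_mul_sum]
  exact Finset.sum_congr rfl fun i _ => Finset.sum_congr rfl fun j _ => mul_mul_mul_comm ..

theorem integrable_sq_interpolant (x : ι → E n) (z : ι → ℝ) :
    Integrable fun p => 𝒯.interpolant x z p ^ 2 := by
  simp only [sq_interpolant_eq_sum]
  exact integrable_finsetSum _ fun i _ => integrable_finsetSum _ fun j _ =>
    (integrable_hat_mul_hat _ _).const_mul _

theorem sq_interpolant_le (hx : Function.Injective x) (z : ι → ℝ) (p : E n) :
    𝒯.interpolant x z p ^ 2 ≤ ∑ i, z i ^ 2 * 𝒯.hat (x i) p := by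
  have hhat : ∀ i, 0 ≤ 𝒯.hat (x i) p := fun i => hat_nonneg _ _
  calc 𝒯.interpolant x z p ^ 2
      ≤ (∑ i, 𝒯.hat (x i) p) * ∑ i, z i ^ 2 * 𝒯.hat (x i) p :=
        Finset.sum_sq_le_sum_mul_sum_of_sq_le_mul _ (fun i _ => hhat i)
          (fun i _ => mul_nonneg (sq_nonneg _) (hhat i)) fun i _ => le_of_eq (by ring)
    _ ≤ ∑ i, z i ^ 2 * 𝒯.hat (x i) p :=
        mul_le_of_le_one_left (Finset.sum_nonneg fun i _ => mul_nonneg (sq_nonneg _) (hhat i))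
          (sum_hat_le_one hx p)

end Interpolant

theorem sum_setIntegral_simplex_le {f : E n → ℝ} (hf : IntegrableOn f 𝒯.domain)
    (hf0 : ∀ p, 0 ≤ f p) :
    ∑ T ∈ 𝒯.finite_cells.toFinset, ∫ p in simplex T, f p ≤ ∫ p in 𝒯.domain, f p := by
  have hsub : ⋃ T ∈ 𝒯.finite_cells.toFinset, interior (simplex T) ⊆ 𝒯.domain :=
    iUnion₂_subset fun T hT => interior_simplex_subset_domain (𝒯.finite_cells.mem_toFinset.1 hT)
  have hdisj : (𝒯.finite_cells.toFinset : Set (Finset (E n))).PairwiseDisjoint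
      fun T => interior (simplex T) := by
    rw [𝒯.finite_cells.coe_toFinset]
    exact fun S hS T hT hST => disjoint_left.2 fun p hpS hpT =>
      hST (cell_eq_of_mem_interior hS hT hpS (interior_subset hpT))
  calc ∑ T ∈ 𝒯.finite_cells.toFinset, ∫ p in simplex T, f p
      = ∑ T ∈ 𝒯.finite_cells.toFinset, ∫ p in interior (simplex T), f p :=
        Finset.sum_congr rfl fun T _ => (setIntegral_congr_set
          (interior_ae_eq_of_null_frontier (volume_frontier_simplex T))).symm
    _ = ∫ p in ⋃ T ∈ 𝒯.finite_cells.toFinset, interior (simplex T), f p :=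
        (integral_biUnion_finset _ (fun _ _ => isOpen_interior.measurableSet) hdisj fun T hT =>
          hf.mono_set ((subset_biUnion_of_mem hT).trans hsub)).symm
    _ ≤ ∫ p in 𝒯.domain, f p :=
        setIntegral_mono_set hf (ae_of_all _ hf0) hsub.eventuallyLE

theorem sum_comp_le_sum_cells {ι : Type*} [Fintype ι] {x : ι → E n} (hx : Function.Injective x)
    (hxv : range x ⊆ 𝒯.vertices) {g : E n → ℝ} (hg : ∀ v, 0 ≤ g v) :
    ∑ i, g (x i) ≤ ∑ T ∈ 𝒯.finite_cells.toFinset, ∑ v ∈ T, g v := by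
  classical
  choose T hT hxT using fun i => exists_cell_of_mem_vertices (hxv (mem_range_self i))
  have hinj : Function.Injective fun i => (⟨T i, x i⟩ : (_ : Finset (E n)) × E n) :=
    fun i j hij => hx (Sigma.mk.inj_iff.1 hij).2.eq
  calc ∑ i, g (x i) = ∑ a ∈ Finset.univ.image fun i => (⟨T i, x i⟩ : (_ : Finset (E n)) × E n),
        g a.2 := (Finset.sum_image (f := fun a => g a.2) hinj.injOn).symm
    _ ≤ ∑ a ∈ 𝒯.finite_cells.toFinset.sigma id, g a.2 :=
        Finset.sum_le_sum_of_subset_of_nonneg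
          (Finset.image_subset_iff.2 fun i _ => Finset.mem_sigma.2
            ⟨𝒯.finite_cells.mem_toFinset.2 (hT i), hxT i⟩) fun a _ _ => hg a.2
    _ = ∑ T ∈ 𝒯.finite_cells.toFinset, ∑ v ∈ T, g v := Finset.sum_sigma _ _ _

theorem volume_mul_sum_sq_le_setIntegral_sq_interpolant {ι : Type*} [Fintype ι] {T : Finset (E n)}
    (hT : T ∈ 𝒯.cells) (x : ι → E n) (z : ι → ℝ) :
    volume.real (simplex T) * ∑ v ∈ T, 𝒯.interpolant x z v ^ 2
      ≤ (n + 1) * (4 ^ (n + 1) * ∫ p in simplex T, 𝒯.interpolant x z p ^ 2) := by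
  obtain ⟨f, hf⟩ := exists_affineMap_eqOn_interpolant hT x z
  rw [setIntegral_congr_fun (isCompact_simplex T).isClosed.measurableSet
      fun p hp => congrArg (· ^ 2) (hf hp),
    Finset.sum_congr rfl fun v hv => congrArg (· ^ 2) (hf (mem_simplex_of_mem hv))]
  simpa [hT.2] using volume_simplex_mul_sum_sq_le_setIntegral T f

theorem CellsContainBall.unitBallVolume_mul_le {δ : ℝ} (hball : 𝒯.CellsContainBall δ) (hδ : 0 ≤ δ)
    {T : Finset (E n)} (hT : T ∈ 𝒯.cells) : unitBallVolume n * δ ^ n ≤ volume.real (simplex T) := by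
  obtain ⟨q, hq⟩ := hball T hT
  rw [← volume_real_closedBall q hδ]
  exact measureReal_mono hq (isCompact_simplex T).measure_ne_top

theorem sum_sq_le_integral_sq_interpolant {ι : Type*} [Fintype ι] {x : ι → E n}
    (hx : Function.Injective x) (hxv : range x ⊆ 𝒯.vertices) {δ : ℝ} (hδ : 0 ≤ δ)
    (hball : 𝒯.CellsContainBall δ) (z : ι → ℝ) :
    unitBallVolume n * δ ^ n * ∑ i, z i ^ 2
      ≤ (n + 1) * (4 ^ (n + 1) * ∫ p in 𝒯.domain, 𝒯.interpolant x z p ^ 2) := by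
  have hω : 0 ≤ unitBallVolume n * δ ^ n := mul_nonneg (unitBallVolume_pos n).le (by positivity)
  calc unitBallVolume n * δ ^ n * ∑ i, z i ^ 2
      = unitBallVolume n * δ ^ n * ∑ i, 𝒯.interpolant x z (x i) ^ 2 := by
        simp only [fun i => interpolant_node hx (hxv (mem_range_self i)) z]
    _ ≤ unitBallVolume n * δ ^ n *
          ∑ T ∈ 𝒯.finite_cells.toFinset, ∑ v ∈ T, 𝒯.interpolant x z v ^ 2 :=
        mul_le_mul_of_nonneg_left (sum_comp_le_sum_cells hx hxv fun v => sq_nonneg _) hω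
    _ ≤ ∑ T ∈ 𝒯.finite_cells.toFinset,
          (n + 1) * (4 ^ (n + 1) * ∫ p in simplex T, 𝒯.interpolant x z p ^ 2) := by
        rw [Finset.mul_sum]
        refine Finset.sum_le_sum fun T hT => ?_
        rw [𝒯.finite_cells.mem_toFinset] at hT
        exact (mul_le_mul_of_nonneg_right (hball.unitBallVolume_mul_le hδ hT)
          (Finset.sum_nonneg fun v _ => sq_nonneg _)).trans
            (volume_mul_sum_sq_le_setIntegral_sq_interpolant hT x z)
    _ ≤ (n + 1) * (4 ^ (n + 1) * ∫ p in 𝒯.domain, 𝒯.interpolant x z p ^ 2) := by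
        rw [← Finset.mul_sum, ← Finset.mul_sum]
        gcongr
        exact sum_setIntegral_simplex_le (integrable_sq_interpolant x z).integrableOn
          fun p => sq_nonneg _

variable {N : ℕ} {x : Fin N → E n}

theorem isHermitian_massMatrix : (𝒯.massMatrix x).IsHermitian := by
  ext i j
  simp [massMatrix, mul_comm]

theorem dotProduct_massMatrix_mulVec (z : Fin N → ℝ) :
    z ⬝ᵥ 𝒯.massMatrix x *ᵥ z = ∫ p in 𝒯.domain, 𝒯.interpolant x z p ^ 2 := by
  simp only [sq_interpolant_eq_sum]
  rw [integral_finsetSum _ fun i _ => integrable_finsetSum _ fun j _ =>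
    ((integrable_hat_mul_hat _ _).const_mul _).integrableOn]
  refine Finset.sum_congr rfl fun i _ => ?_
  rw [integral_finsetSum _ fun j _ => ((integrable_hat_mul_hat _ _).const_mul _).integrableOn,
    mulVec, dotProduct, Finset.mul_sum]
  refine Finset.sum_congr rfl fun j _ => ?_
  rw [integral_const_mul, massMatrix, of_apply]
  ring

theorem dotProduct_lumpedMassMatrix_mulVec (z : Fin N → ℝ) :
    z ⬝ᵥ 𝒯.lumpedMassMatrix x *ᵥ z = ∫ p in 𝒯.domain, ∑ i, z i ^ 2 * 𝒯.hat (x i) p := by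
  rw [integral_finsetSum _ fun i _ => ((integrable_hat _).const_mul _).integrableOn]
  refine Finset.sum_congr rfl fun i _ => ?_
  rw [integral_const_mul, lumpedMassMatrix, mulVec_diagonal]
  ring

theorem massMatrix_le_lumpedMassMatrix (hx : Function.Injective x) :
    𝒯.massMatrix x ≤ 𝒯.lumpedMassMatrix x := by
  refine le_of_dotProduct_mulVec_le isHermitian_massMatrix (isHermitian_diagonal _) fun z => ?_
  rw [dotProduct_massMatrix_mulVec, dotProduct_lumpedMassMatrix_mulVec]
  exact setIntegral_mono (integrable_sq_interpolant x z).integrableOn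
    (integrable_finsetSum _ fun i _ => (integrable_hat _).const_mul _).integrableOn
    (sq_interpolant_le hx z)

theorem lumpedMassMatrix_le (hh : 0 ≤ 𝒯.meshSize) :
    𝒯.lumpedMassMatrix x ≤ (unitBallVolume n * 𝒯.meshSize ^ n) • 1 := by
  rw [Matrix.le_iff, lumpedMassMatrix, smul_one_eq_diagonal, diagonal_sub]
  exact .diagonal fun i => sub_nonneg.2 (integral_domain_hat_le hh (x i))

theorem smul_one_le_massMatrix (hx : Function.Injective x) (hxv : range x ⊆ 𝒯.vertices) {δ : ℝ}
    (hδ : 0 ≤ δ) (hball : 𝒯.CellsContainBall δ) :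
    (unitBallVolume n * δ ^ n / ((n + 1) * 4 ^ (n + 1))) • 1 ≤ 𝒯.massMatrix x := by
  refine le_of_dotProduct_mulVec_le (isHermitian_one.smul (.all _)) isHermitian_massMatrix
    fun z => ?_
  rw [dotProduct_massMatrix_mulVec, smul_mulVec, one_mulVec, dotProduct_smul, smul_eq_mul,
    div_mul_eq_mul_div, div_le_iff₀' (by positivity), mul_assoc ((n : ℝ) + 1)]
  simpa only [dotProduct, ← sq] using sum_sq_le_integral_sq_interpolant hx hxv hδ hball z

end Triangulation

theorem exists_ae_abs_le_of_memLp_top {β : Type*} [MeasurableSpace β] {μ : Measure β} {f : β → ℝ}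
    (hf : MemLp f ⊤ μ) : ∃ C, 0 ≤ C ∧ ∀ᵐ p ∂μ, |f p| ≤ C := by
  have hlt : eLpNormEssSup f μ ≠ ⊤ := eLpNorm_exponent_top (f := f) ▸ hf.2.ne
  refine ⟨(eLpNormEssSup f μ).toReal, ENNReal.toReal_nonneg, ?_⟩
  filter_upwards [ae_le_eLpNormEssSup (f := f) (μ := μ)] with p hp
  simpa using ENNReal.toReal_mono hlt hp

theorem abs_sum_sum_mul_mul_le {ι : Type*} [Fintype ι] (b : ι → ι → ℝ) {u v : ι → ℝ} {r : ℝ}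
    (hu : ∀ k, |u k| ≤ r) (hv : ∀ l, |v l| ≤ r) :
    |∑ k, ∑ l, b l k * u k * v l| ≤ (∑ k, ∑ l, |b k l|) * r ^ 2 := by
  rw [Finset.sum_comm, Finset.sum_mul]
  refine (Finset.abs_sum_le_sum_abs _ _).trans (Finset.sum_le_sum fun l _ => ?_)
  rw [Finset.sum_mul]
  refine (Finset.abs_sum_le_sum_abs _ _).trans (Finset.sum_le_sum fun k _ => ?_)
  rw [abs_mul, abs_mul, mul_assoc, sq]
  gcongr
  exacts [(abs_nonneg _).trans (hu k), hu k, hv l]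

theorem bilinForm_comm {n : ℕ} {Ω : Set (E n)} {a : Fin n → Fin n → E n → ℝ}
    (hsymm : ∀ᵐ p ∂volume.restrict Ω, ∀ i j, a i j p = a j i p) (c₀ y v : E n → ℝ) :
    bilinForm Ω a c₀ y v = bilinForm Ω a c₀ v y := by
  refine integral_congr_ae ?_
  filter_upwards [hsymm] with p hp
  rw [Finset.sum_comm, mul_right_comm]
  simp only [hp _, mul_right_comm]

namespace Triangulation

section Stiffness

open Function Matrix

variable {n : ℕ} {𝒯 : Triangulation n} {Ω : Set (E n)} {a : Fin n → Fin n → E n → ℝ}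
  {c₀ : E n → ℝ} {δ A B : ℝ}

theorem ae_abs_integrand_le_indicator (hδ : 0 < δ) (hball : 𝒯.CellsContainBall δ)
    (ha : ∀ᵐ p ∂volume.restrict Ω, ∑ k, ∑ l, |a k l p| ≤ A)
    (hc : ∀ᵐ p ∂volume.restrict Ω, |c₀ p| ≤ B) (v w : E n) :
    ∀ᵐ p ∂volume.restrict Ω,
      |(∑ k, ∑ l, a l k p * pderiv k (𝒯.hat v) p * pderiv l (𝒯.hat w) p)
          + c₀ p * 𝒯.hat v p * 𝒯.hat w p|
        ≤ (support (𝒯.hat v) ∩ support (𝒯.hat w)).indicator (fun _ => A / δ ^ 2 + B) p := by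
  filter_upwards [ha, hc, ae_restrict_of_ae (ae_abs_pderiv_hat_le hδ hball)] with p hap hcp hp
  by_cases hmem : p ∈ support (𝒯.hat v) ∩ support (𝒯.hat w)
  · have hgrad : |∑ k, ∑ l, a l k p * pderiv k (𝒯.hat v) p * pderiv l (𝒯.hat w) p|
        ≤ A * (1 / δ) ^ 2 :=
      (abs_sum_sum_mul_mul_le (fun k l => a k l p) (hp v) (hp w)).trans (by gcongr)
    have hzero : |c₀ p * 𝒯.hat v p * 𝒯.hat w p| ≤ B * 1 * 1 := by
      rw [abs_mul, abs_mul, abs_of_nonneg (hat_nonneg v p), abs_of_nonneg (hat_nonneg w p)]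
      have hB : 0 ≤ B := (abs_nonneg _).trans hcp
      gcongr
      exacts [hat_nonneg w p, hat_nonneg v p, hat_le_one v p, hat_le_one w p]
    rw [indicator_of_mem hmem]
    calc _ ≤ A * (1 / δ) ^ 2 + B * 1 * 1 := (abs_add_le _ _).trans (add_le_add hgrad hzero)
      _ = A / δ ^ 2 + B := by ring
  · rw [indicator_of_notMem hmem]
    obtain hv | hw := (not_and_or.1 hmem).imp notMem_support.1 notMem_support.1
    · simp [hv, pderiv_hat_eq_zero hv]
    · simp [hw, pderiv_hat_eq_zero hw]

theorem integrable_indicator_support_inter (v w : E n) (c : ℝ) :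
    Integrable ((support (𝒯.hat v) ∩ support (𝒯.hat w)).indicator fun _ => c) := by
  refine (integrable_indicator_iff ((measurableSet_support (measurable_hat v)).inter
    (measurableSet_support (measurable_hat w)))).2 (integrableOn_const ?_)
  exact (measure_mono fun p hp => mem_closedBall_of_hat_ne_zero hp.1).trans_lt
    (measure_closedBall_lt_top (x := v) (r := 𝒯.meshSize)) |>.ne

theorem abs_bilinForm_hat_le (hδ : 0 < δ) (hball : 𝒯.CellsContainBall δ)
    (ha : ∀ᵐ p ∂volume.restrict Ω, ∑ k, ∑ l, |a k l p| ≤ A)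
    (hc : ∀ᵐ p ∂volume.restrict Ω, |c₀ p| ≤ B) (v w : E n) :
    |bilinForm Ω a c₀ (𝒯.hat v) (𝒯.hat w)|
      ≤ ∫ p in Ω, (support (𝒯.hat v) ∩ support (𝒯.hat w)).indicator
          (fun _ => A / δ ^ 2 + B) p := by
  rw [bilinForm, ← Real.norm_eq_abs]
  exact norm_integral_le_of_norm_le (integrable_indicator_support_inter v w _).integrableOn
    (ae_abs_integrand_le_indicator hδ hball ha hc v w)

theorem sum_indicator_support_inter_le {ι : Type*} [Fintype ι] {x : ι → E n}
    (hx : Function.Injective x) {c : ℝ} (hc : 0 ≤ c) (i : ι) (p : E n) :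
    ∑ j, (support (𝒯.hat (x i)) ∩ support (𝒯.hat (x j))).indicator (fun _ => c) p
      ≤ (Metric.closedBall (x i) 𝒯.meshSize).indicator (fun _ => (n + 1) * c) p := by
  classical
  by_cases hi : 𝒯.hat (x i) p = 0
  · simpa [hi] using indicator_nonneg (fun _ _ => by positivity) p
  · rw [indicator_of_mem (mem_closedBall_of_hat_ne_zero hi)]
    calc ∑ j, (support (𝒯.hat (x i)) ∩ support (𝒯.hat (x j))).indicator (fun _ => c) p
        = (Finset.univ.filter fun j => 𝒯.hat (x j) p ≠ 0).card * c := by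
          simp [indicator_apply, hi, Finset.sum_ite]
      _ ≤ (n + 1) * c := by
          gcongr
          exact_mod_cast card_hat_ne_zero_le hx p

variable {N : ℕ} {x : Fin N → E n}

theorem isHermitian_stiffnessMatrix
    (hsymm : ∀ᵐ p ∂volume.restrict Ω, ∀ i j, a i j p = a j i p) :
    (𝒯.stiffnessMatrix x Ω a c₀).IsHermitian := by
  ext i j
  exact bilinForm_comm hsymm c₀ _ _

theorem sum_abs_stiffnessMatrix_le (hx : Function.Injective x) (hh : 0 ≤ 𝒯.meshSize)
    (hδ : 0 < δ) (hball : 𝒯.CellsContainBall δ) (hA : 0 ≤ A) (hB : 0 ≤ B)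
    (ha : ∀ᵐ p ∂volume.restrict Ω, ∑ k, ∑ l, |a k l p| ≤ A)
    (hc : ∀ᵐ p ∂volume.restrict Ω, |c₀ p| ≤ B) (i : Fin N) :
    ∑ j, |𝒯.stiffnessMatrix x Ω a c₀ i j|
      ≤ (n + 1) * (A / δ ^ 2 + B) * (unitBallVolume n * 𝒯.meshSize ^ n) := by
  have hint : Integrable ((Metric.closedBall (x i) 𝒯.meshSize).indicator
      fun _ => (n + 1) * (A / δ ^ 2 + B)) :=
    (integrable_indicator_iff measurableSet_closedBall).2
      (integrableOn_const measure_closedBall_lt_top.ne)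
  have hAB : 0 ≤ A / δ ^ 2 + B := by positivity
  calc ∑ j, |𝒯.stiffnessMatrix x Ω a c₀ i j|
      ≤ ∑ j, ∫ p in Ω, (support (𝒯.hat (x i)) ∩ support (𝒯.hat (x j))).indicator
          (fun _ => A / δ ^ 2 + B) p :=
        Finset.sum_le_sum fun j _ => abs_bilinForm_hat_le hδ hball ha hc (x i) (x j)
    _ = ∫ p in Ω, ∑ j, (support (𝒯.hat (x i)) ∩ support (𝒯.hat (x j))).indicator
          (fun _ => A / δ ^ 2 + B) p :=
        (integral_finsetSum _ fun j _ =>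
          (integrable_indicator_support_inter _ _ _).integrableOn).symm
    _ ≤ ∫ p in Ω, (Metric.closedBall (x i) 𝒯.meshSize).indicator
          (fun _ => (n + 1) * (A / δ ^ 2 + B)) p :=
        setIntegral_mono (integrable_finsetSum _ fun j _ =>
          integrable_indicator_support_inter _ _ _).integrableOn hint.integrableOn
            (sum_indicator_support_inter_le hx hAB i)
    _ ≤ ∫ p, (Metric.closedBall (x i) 𝒯.meshSize).indicator
          (fun _ => (n + 1) * (A / δ ^ 2 + B)) p :=
        setIntegral_le_integral hint
          (ae_of_all _ (indicator_nonneg fun _ _ => by positivity))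
    _ = (n + 1) * (A / δ ^ 2 + B) * (unitBallVolume n * 𝒯.meshSize ^ n) := by
        rw [integral_indicator_const _ measurableSet_closedBall, smul_eq_mul,
          volume_real_closedBall _ hh, mul_comm]

end Stiffness

open Matrix
open scoped MatrixOrder

theorem gamma_pos (n : ℕ) : 0 < gamma n := by
  rw [gamma]; split_ifs <;> norm_num

theorem gamma_le_five (n : ℕ) : gamma n ≤ 5 := by
  rw [gamma]; split_ifs <;> norm_num

section

variable {n N : ℕ} {𝒯 : Triangulation n} {x : Fin N → E n} {Ω : Set (E n)}
  {a : Fin n → Fin n → E n → ℝ} {c₀ : E n → ℝ} {α w : ℝ}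

theorem massMatrix_le_matrixG (hK : (𝒯.stiffnessMatrix x Ω a c₀).IsHermitian)
    (hM : (𝒯.massMatrix x).PosDef) (hα : 0 ≤ α) : 𝒯.massMatrix x ≤ 𝒯.matrixG x Ω a c₀ α :=
  le_add_of_nonneg_right (smul_nonneg hα (mul_inv_mul_nonneg hK hM))

theorem matrixG_le_smul_one (hK : (𝒯.stiffnessMatrix x Ω a c₀).IsHermitian) (hα : 0 ≤ α) {m R : ℝ}
    (hm : 0 < m) (hmM : m • 1 ≤ 𝒯.massMatrix x) (hMw : 𝒯.massMatrix x ≤ w • 1)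
    (hR : ∀ i, ∑ j, |𝒯.stiffnessMatrix x Ω a c₀ i j| ≤ R) :
    𝒯.matrixG x Ω a c₀ α ≤ (w + α * (m⁻¹ * R ^ 2)) • 1 := by
  rw [add_smul, mul_smul, mul_smul]
  refine add_le_add hMw (smul_le_smul_of_nonneg_left ?_ hα)
  exact (mul_inv_mul_le_inv_smul hK hm hmM).trans
    (smul_le_smul_of_nonneg_left (mul_self_le_smul_one_of_sum_abs_le hK hR) (inv_nonneg.2 hm.le))

theorem matrixMGM_nonneg (hK : (𝒯.stiffnessMatrix x Ω a c₀).IsHermitian)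
    (hM : (𝒯.massMatrix x).PosDef) (hα : 0 ≤ α) : 0 ≤ 𝒯.matrixMGM x Ω a c₀ α :=
  mul_inv_mul_nonneg isHermitian_massMatrix (posDef_of_le hM (massMatrix_le_matrixG hK hM hα))

theorem matrixMGM_le_massMatrix (hK : (𝒯.stiffnessMatrix x Ω a c₀).IsHermitian)
    (hM : (𝒯.massMatrix x).PosDef) (hα : 0 ≤ α) : 𝒯.matrixMGM x Ω a c₀ α ≤ 𝒯.massMatrix x :=
  mul_inv_mul_le_self hM (massMatrix_le_matrixG hK hM hα)

theorem matrixS_nonneg (hx : Function.Injective x)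
    (hK : (𝒯.stiffnessMatrix x Ω a c₀).IsHermitian) (hM : (𝒯.massMatrix x).PosDef)
    (hα : 0 ≤ α) : 0 ≤ 𝒯.matrixS x Ω a c₀ α := by
  have hMW := massMatrix_le_lumpedMassMatrix (𝒯 := 𝒯) hx
  have hfirst : 0 ≤ 𝒯.matrixMGM x Ω a c₀ α + 𝒯.lumpedMassMatrix x - 𝒯.massMatrix x := by
    rw [add_sub_assoc]
    exact add_nonneg (matrixMGM_nonneg hK hM hα) (sub_nonneg.2 hMW)
  have hlast : 0 ≤ 𝒯.massMatrix x * (𝒯.lumpedMassMatrix x)⁻¹ * 𝒯.massMatrix x :=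
    mul_inv_mul_nonneg isHermitian_massMatrix (posDef_of_le hM hMW)
  refine smul_nonneg (one_div_nonneg.2 hα) (posSemidef_fromBlocks_zero
    (posSemidef_fromBlocks_zero ?_ .zero) ?_).nonneg
  · exact nonneg_iff_posSemidef.1 hfirst
  · exact nonneg_iff_posSemidef.1 (smul_nonneg (gamma_pos n).le hlast)

theorem matrixS_le_smul_one (hx : Function.Injective x)
    (hK : (𝒯.stiffnessMatrix x Ω a c₀).IsHermitian) (hM : (𝒯.massMatrix x).PosDef)
    (hα : 0 ≤ α) (hw : 0 ≤ w) (hWw : 𝒯.lumpedMassMatrix x ≤ w • 1) :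
    𝒯.matrixS x Ω a c₀ α ≤ (1 / α * (5 * w)) • 1 := by
  have hMW := massMatrix_le_lumpedMassMatrix (𝒯 := 𝒯) hx
  have hone : (0 : Matrix (Fin N) (Fin N) ℝ) ≤ 1 := zero_le_one
  have hw5 : w • (1 : Matrix (Fin N) (Fin N) ℝ) ≤ (5 * w) • 1 :=
    smul_le_smul_of_nonneg_right (by linarith) hone
  have hfirst : 𝒯.matrixMGM x Ω a c₀ α + 𝒯.lumpedMassMatrix x - 𝒯.massMatrix x ≤ (5 * w) • 1 := by
    rw [add_comm, add_sub_assoc]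
    exact (add_le_of_nonpos_right (sub_nonpos.2 (matrixMGM_le_massMatrix hK hM hα))).trans
      (hWw.trans hw5)
  have hlast : gamma n • (𝒯.massMatrix x * (𝒯.lumpedMassMatrix x)⁻¹ * 𝒯.massMatrix x)
      ≤ (5 * w) • 1 :=
    calc gamma n • (𝒯.massMatrix x * (𝒯.lumpedMassMatrix x)⁻¹ * 𝒯.massMatrix x)
        ≤ gamma n • w • 1 := smul_le_smul_of_nonneg_left
          ((mul_inv_mul_le_self hM hMW).trans (hMW.trans hWw)) (gamma_pos n).le
      _ ≤ (5 * w) • 1 := by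
          rw [smul_smul]
          exact smul_le_smul_of_nonneg_right
            (mul_le_mul_of_nonneg_right (gamma_le_five n) hw) hone
  rw [mul_smul]
  refine smul_le_smul_of_nonneg_left (fromBlocks_zero_le_smul_one
    (fromBlocks_zero_le_smul_one hfirst ?_) hlast) (one_div_nonneg.2 hα)
  exact smul_nonneg (by positivity) zero_le_one

theorem exists_isLargestEigenvalue_matrixMGM_abs_le [Nonempty (Fin N)]
    (hK : (𝒯.stiffnessMatrix x Ω a c₀).IsHermitian) (hM : (𝒯.massMatrix x).PosDef)
    (hα : 0 ≤ α) (hMw : 𝒯.massMatrix x ≤ w • 1) :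
    ∃ Λ, IsLargestEigenvalue (𝒯.matrixMGM x Ω a c₀ α) Λ ∧ |Λ| ≤ w :=
  exists_isLargestEigenvalue_abs_le (nonneg_iff_posSemidef.1 (matrixMGM_nonneg hK hM hα))
    ((matrixMGM_le_massMatrix hK hM hα).trans hMw)

theorem exists_isLargestEigenvalue_matrixS_abs_le [Nonempty (Fin N)] (hx : Function.Injective x)
    (hK : (𝒯.stiffnessMatrix x Ω a c₀).IsHermitian) (hM : (𝒯.massMatrix x).PosDef)
    (hα : 0 ≤ α) (hw : 0 ≤ w) (hWw : 𝒯.lumpedMassMatrix x ≤ w • 1) :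
    ∃ Λ, IsLargestEigenvalue (𝒯.matrixS x Ω a c₀ α) Λ ∧ |Λ| ≤ 1 / α * (5 * w) :=
  exists_isLargestEigenvalue_abs_le (nonneg_iff_posSemidef.1 (matrixS_nonneg hx hK hM hα))
    (matrixS_le_smul_one hx hK hM hα hw hWw)

end

variable {n : ℕ} {Ω : Set (E n)} {a : Fin n → Fin n → E n → ℝ} {c₀ : E n → ℝ} {α κ τ : ℝ}

theorem exists_smul_one_le_massMatrix (n : ℕ) (hκ : 0 < κ) (hτ : 0 < τ) :
    ∃ l, 0 < l ∧ ∀ 𝒯 : Triangulation n, 0 < 𝒯.meshSize → 𝒯.IsRegularQuasiUniform κ τ →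
      ∀ (N : ℕ) (x : Fin N → E n), Function.Injective x → range x ⊆ 𝒯.vertices →
        (l * 𝒯.meshSize ^ n) • 1 ≤ 𝒯.massMatrix x := by
  have hω := unitBallVolume_pos n
  refine ⟨unitBallVolume n / (4 * κ * τ) ^ n / ((n + 1) * 4 ^ (n + 1)), by positivity,
    fun 𝒯 hh hreg N x hx hxv => ?_⟩
  convert smul_one_le_massMatrix hx hxv (by positivity) (hreg.cellsContainBall hκ hτ hh) using 2
  rw [div_pow]
  ring

theorem exists_sum_abs_stiffnessMatrix_le (ha : ∀ i j, MemLp (a i j) ⊤ (volume.restrict Ω))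
    (hc : MemLp c₀ ⊤ (volume.restrict Ω)) (hκ : 0 < κ) (hτ : 0 < τ) :
    ∃ R, ∀ 𝒯 : Triangulation n, 0 < 𝒯.meshSize → 𝒯.meshSize ≤ 1 →
      𝒯.IsRegularQuasiUniform κ τ → ∀ (N : ℕ) (x : Fin N → E n), Function.Injective x →
        ∀ i, ∑ j, |𝒯.stiffnessMatrix x Ω a c₀ i j| ≤ R * (𝒯.meshSize ^ n / 𝒯.meshSize ^ 2) := by
  obtain ⟨A, hA, haA⟩ := exists_ae_abs_le_of_memLp_top <|
    memLp_finsetSum Finset.univ fun k _ => memLp_finsetSum Finset.univ fun l _ => (ha k l).abs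
  obtain ⟨B, hB, hcB⟩ := exists_ae_abs_le_of_memLp_top hc
  have hω := unitBallVolume_pos n
  refine ⟨(n + 1) * (A * (4 * κ * τ) ^ 2 + B) * unitBallVolume n,
    fun 𝒯 hh hh1 hreg N x hx i => ?_⟩
  set h := 𝒯.meshSize
  have hBh : B ≤ B / h ^ 2 := le_div_self hB (by positivity) (pow_le_one₀ hh.le hh1)
  calc ∑ j, |𝒯.stiffnessMatrix x Ω a c₀ i j|
      ≤ (n + 1) * (A / (h / (4 * κ * τ)) ^ 2 + B) * (unitBallVolume n * h ^ n) :=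
        sum_abs_stiffnessMatrix_le hx hh.le (by positivity) (hreg.cellsContainBall hκ hτ hh) hA hB
          (haA.mono fun p hp => (le_abs_self _).trans hp) hcB i
    _ ≤ (n + 1) * (A / (h / (4 * κ * τ)) ^ 2 + B / h ^ 2) * (unitBallVolume n * h ^ n) := by gcongr
    _ = (n + 1) * (A * (4 * κ * τ) ^ 2 + B) * unitBallVolume n * (h ^ n / h ^ 2) := by
        field_simp

theorem exists_matrixG_le_smul_one (ha : ∀ i j, MemLp (a i j) ⊤ (volume.restrict Ω))
    (hc : MemLp c₀ ⊤ (volume.restrict Ω))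
    (hsymm : ∀ᵐ p ∂volume.restrict Ω, ∀ i j, a i j p = a j i p)
    (hα : 0 ≤ α) (hκ : 0 < κ) (hτ : 0 < τ) :
    ∃ u, 0 < u ∧ ∀ 𝒯 : Triangulation n, 0 < 𝒯.meshSize → 𝒯.meshSize ≤ 1 →
      𝒯.IsRegularQuasiUniform κ τ → ∀ (N : ℕ) (x : Fin N → E n), Function.Injective x →
        range x ⊆ 𝒯.vertices →
          𝒯.matrixG x Ω a c₀ α ≤ (u * (𝒯.meshSize ^ n / 𝒯.meshSize ^ 4)) • 1 := by
  obtain ⟨l, hl, hlM⟩ := exists_smul_one_le_massMatrix n hκ hτ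
  obtain ⟨R, hRK⟩ := exists_sum_abs_stiffnessMatrix_le ha hc hκ hτ
  have hω := unitBallVolume_pos n
  refine ⟨unitBallVolume n + α * (l⁻¹ * R ^ 2), by positivity,
    fun 𝒯 hh hh1 hreg N x hx hxv => ?_⟩
  refine (matrixG_le_smul_one (isHermitian_stiffnessMatrix hsymm) hα (by positivity)
    (hlM 𝒯 hh hreg N x hx hxv)
    ((massMatrix_le_lumpedMassMatrix hx).trans (lumpedMassMatrix_le hh.le))
    (hRK 𝒯 hh hh1 hreg N x hx)).trans (smul_le_smul_of_nonneg_right ?_ zero_le_one)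
  set h := 𝒯.meshSize
  have hhn : h ^ n ≤ h ^ n / h ^ 4 :=
    le_div_self (by positivity) (by positivity) (pow_le_one₀ hh.le hh1)
  calc unitBallVolume n * h ^ n + α * ((l * h ^ n)⁻¹ * (R * (h ^ n / h ^ 2)) ^ 2)
      ≤ unitBallVolume n * (h ^ n / h ^ 4)
          + α * ((l * h ^ n)⁻¹ * (R * (h ^ n / h ^ 2)) ^ 2) := by gcongr
    _ = (unitBallVolume n + α * (l⁻¹ * R ^ 2)) * (h ^ n / h ^ 4) := by
        field_simp

end Triangulation

end FEM

open FEM Triangulation in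
open scoped MatrixOrder in
theorem mainTheorem5_general {n : ℕ} {Ω : Set (E n)} {a : Fin n → Fin n → E n → ℝ}
    {c₀ : E n → ℝ} (ha : ∀ i j, MemLp (a i j) ⊤ (volume.restrict Ω))
    (hc : MemLp c₀ ⊤ (volume.restrict Ω))
    (hsymm : ∀ᵐ p ∂volume.restrict Ω, ∀ i j, a i j p = a j i p)
    {α κ τ : ℝ} (hα : 0 < α) (hκ : 0 < κ) (hτ : 0 < τ) :
    ∃ l u C : ℝ, 0 < l ∧ 0 < u ∧ 0 < C ∧
      ∀ 𝒯 : Triangulation n, 0 < 𝒯.meshSize → 𝒯.meshSize ≤ 1 → 𝒯.IsRegularQuasiUniform κ τ →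
        ∀ (N : ℕ) (x : Fin N → E n), Function.Injective x → range x ⊆ 𝒯.vertices →
          (∀ z : Fin N → ℝ, z ≠ 0 →
            l * 𝒯.meshSize ^ n ≤ rayleigh (𝒯.matrixG x Ω a c₀ α) z ∧
            rayleigh (𝒯.matrixG x Ω a c₀ α) z ≤ u * (𝒯.meshSize ^ n / 𝒯.meshSize ^ 4)) ∧
          (0 < N →
            (∃ Λ, IsLargestEigenvalue (𝒯.matrixMGM x Ω a c₀ α) Λ ∧
              |Λ| ≤ C * 𝒯.meshSize ^ n) ∧
            (∃ Λ, IsLargestEigenvalue (𝒯.matrixS x Ω a c₀ α) Λ ∧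
              |Λ| ≤ C * 𝒯.meshSize ^ n)) := by
  obtain ⟨l, hl, hlM⟩ := exists_smul_one_le_massMatrix n hκ hτ
  obtain ⟨u, hu, huG⟩ := exists_matrixG_le_smul_one ha hc hsymm hα.le hκ hτ
  have hω := unitBallVolume_pos n
  refine ⟨l, u, unitBallVolume n + 1 / α * (5 * unitBallVolume n), hl, hu, by positivity,
    fun 𝒯 hh hh1 hreg N x hx hxv => ?_⟩
  have hK := isHermitian_stiffnessMatrix (𝒯 := 𝒯) (x := x) (c₀ := c₀) hsymm
  have hMl := hlM 𝒯 hh hreg N x hx hxv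
  have hM := posDef_of_le (posDef_smul_one (by positivity)) hMl
  refine ⟨fun z hz => ⟨le_rayleigh (hMl.trans (massMatrix_le_matrixG hK hM hα.le)) hz,
    rayleigh_le (huG 𝒯 hh hh1 hreg N x hx hxv) hz⟩, fun hN => ?_⟩
  have := Fin.pos_iff_nonempty.1 hN
  have hw : 0 ≤ unitBallVolume n * 𝒯.meshSize ^ n := by positivity
  have hWw := lumpedMassMatrix_le (x := x) hh.le
  have hMw := (massMatrix_le_lumpedMassMatrix hx).trans hWw
  obtain ⟨Λ, hΛ, hΛle⟩ := exists_isLargestEigenvalue_matrixMGM_abs_le hK hM hα.le hMw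
  obtain ⟨Λ', hΛ', hΛle'⟩ := exists_isLargestEigenvalue_matrixS_abs_le hx hK hM hα.le hw hWw
  refine ⟨⟨Λ, hΛ, hΛle.trans ?_⟩, Λ', hΛ', hΛle'.trans ?_⟩
  · gcongr
    exact le_add_of_nonneg_right (by positivity)
  · rw [← mul_assoc 5, ← mul_assoc]
    gcongr
    exact le_add_of_nonneg_left hω.le

theorem mainTheorem5 (n : ℕ) (hn : n = 2 ∨ n = 3)
    (Ω : Set (FEM.E n)) (hΩo : IsOpen Ω) (hΩc : Convex ℝ Ω) (hΩb : Bornology.IsBounded Ω)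
    (a : Fin n → Fin n → FEM.E n → ℝ) (c₀ : FEM.E n → ℝ) (θ : ℝ)
    (hL : FEM.IsElliptic Ω a c₀ θ)
    (α : ℝ) (hα : 0 < α) (κ τ : ℝ) (hκ : 0 < κ) (hτ : 0 < τ) :
    ∃ l₁ l₂ u₁ u₂ C h₀ : ℝ, 0 < l₁ ∧ 0 < l₂ ∧ 0 < u₁ ∧ 0 < u₂ ∧ 0 < C ∧ 0 < h₀ ∧
      ∀ (𝒯 : FEM.Triangulation n) (h : ℝ), 𝒯.meshSize = h → 0 < h → h < h₀ →
        𝒯.IsRegularQuasiUniform κ τ → 𝒯.domain ⊆ Ω →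
        ∀ (N : ℕ) (x : Fin N → FEM.E n), Function.Injective x →
          (Set.range x = 𝒯.interiorVertices ∨ Set.range x = 𝒯.vertices) →
          (∀ z : Fin N → ℝ, z ≠ 0 →
            (n = 2 →
              l₁ * h ^ 2 ≤ FEM.rayleigh (𝒯.matrixG x Ω a c₀ α) z ∧
              FEM.rayleigh (𝒯.matrixG x Ω a c₀ α) z ≤ u₁ * (1 / h ^ 2)) ∧
            (n = 3 →
              l₂ * h ^ 3 ≤ FEM.rayleigh (𝒯.matrixG x Ω a c₀ α) z ∧
              FEM.rayleigh (𝒯.matrixG x Ω a c₀ α) z ≤ u₂ * (1 / h))) ∧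
          (0 < N →
            (∃ Λ : ℝ, FEM.IsLargestEigenvalue (𝒯.matrixMGM x Ω a c₀ α) Λ ∧
              (n = 2 → |Λ| ≤ C * h ^ 2) ∧ (n = 3 → |Λ| ≤ C * h ^ 3)) ∧
            (∃ Λ : ℝ, FEM.IsLargestEigenvalue (𝒯.matrixS x Ω a c₀ α) Λ ∧
              (n = 2 → |Λ| ≤ C * h ^ 2) ∧ (n = 3 → |Λ| ≤ C * h ^ 3))) := by
  obtain ⟨l, u, C, hl, hu, hC, hmain⟩ :=
    mainTheorem5_general hL.memLp_a hL.memLp_c₀ hL.symm hα hκ hτ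
  refine ⟨l, l, u, u, C, 1, hl, hl, hu, hu, hC, one_pos, ?_⟩
  rintro 𝒯 _ rfl hh hh1 hreg - N x hx hxv
  have hxvert : range x ⊆ 𝒯.vertices :=
    hxv.elim (fun h => h.trans_subset fun _ hv => hv.1) Eq.subset
  obtain ⟨hG, hΛ⟩ := hmain 𝒯 hh hh1.le hreg N x hx hxvert
  have h2 : 𝒯.meshSize ^ 2 / 𝒯.meshSize ^ 4 = 1 / 𝒯.meshSize ^ 2 := by field_simp
  have h3 : 𝒯.meshSize ^ 3 / 𝒯.meshSize ^ 4 = 1 / 𝒯.meshSize := by field_simp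
  obtain rfl | rfl := hn
  · simpa [← h2] using And.intro hG hΛ
  · simpa [← h3] using And.intro hG hΛ
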